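/- \textbf{Definitions.} A \emph{polymatroid} $(E,f)$ is a set $E$ (possibly infinite) with a function $f$ from the subsets of $E$ to $\mathbb{R}$ that is monotone, submodular and satisfies $f(\emptyset)=0$; it is \emph{of finite type} if $f(A)=\sup\{f(F): F\subseteq A \text{ finite}\}$ for every $A\subseteq E$. Write $f(a_1,\dots,a_k)=f(\{a_1,\dots,a_k\})$ and $\mathrm{cl}(A)=\{x\in E: f(A\cup\{x\})=f(A)\}$. A polymatroid $(E,h)$ is \emph{entropic} if there are random variables $(X_i)_{i\in E}$ on one finite probability space such that $h(A)$ is the Shannon entropy (to base $2$) of $X_A=(X_i)_{i\in A}$ for all $A\subseteq E$. A polymatroid of finite type is \emph{almost entropic} if it is the pointwise limit of a sequence of entropic polymatroids on the same ground set. Let $S$ be a set with an involution $s\mapsto s^{-1}$ and a distinguished element $e$ with $e^{-1}=e$. A \emph{partial Dowling geometry} (PDG) of rank $r$ with generating set $S$ is a triple $(E,f,S)$, where $(E,f)$ is a polymatroid such that \begin{itemize} \item $E$ is the disjoint union of a set $B=\{b_1,\dots,b_r\}$ of $r$ elements and of copies $\{s_{i,j}: s\in S\}$ of $S$, one for each pair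 $1\le i<j\le r$; for $i<j$ one writes $s_{j,i}=(s^{-1})_{i,j}$; \item $f(A)=|A|$ for all $A\subseteq B$; \item for all $s\in S$ and distinct $i,j$: $s_{i,j}\in\mathrm{cl}(\{b_i,b_j\})$, $f(s_{i,j})=1$ and $f(b_i,s_{i,j})=2$; \item for all $s\in S$ and distinct $i,j,k$: $f\big(s_{i,j},(s^{-1})_{j,k},e_{k,i}\big)=2$. \end{itemize} \textbf{Theorem.} Let $(E,f,S)$ be an almost entropic PDG of rank $3$ whose generating set $S$ is finite or countably infinite. Then there exists an almost entropic PDG $(\tilde E,\tilde f,S)$ of rank $4$, on the same generating set (with the same involution and the same distinguished element), that extends $(E,f)$: there is an injective map $E\to\tilde E$ that preserves the rank of every subset of $E$, and it sends $b_i$ to $b_i$ and $s_{i,j}$ to $s_{i,j}$ for all $s\in S$ and distinct $i,j\in\{1,2,3\}$. -/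

import Mathlib

open Filter Topology

universe u v

/-- Polymatroid axioms for a rank function `f` on all subsets of a ground set `E`
(possibly infinite). -/
structure IsPolymatroid {E : Type*} (f : Set E → ℝ) : Prop where
  empty : f ∅ = 0
  mono : ∀ A B : Set E, A ⊆ B → f A ≤ f B
  submodular : ∀ A B : Set E, f (A ∪ B) + f (A ∩ B) ≤ f A + f B

/-- `f` is of finite type: every `f A` is the supremum of the values of `f` on the finite subsets
of `A`. For a polymatroid on a finite set this is automatic. -/
def IsFiniteType {E : Type*} (f : Set E → ℝ) : Prop :=
  ∀ A : Set E, IsLUB {x : ℝ | ∃ F : Set E, F.Finite ∧ F ⊆ A ∧ f F = x} (f A)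

/-- The closure operator `cl(A) = {x | f(A) = f(A ∪ {x})}`. -/
def polyClosure {E : Type*} (f : Set E → ℝ) (A : Set E) : Set E :=
  {x : E | f A = f (A ∪ {x})}

/-- Shannon entropy, to base 2, of a random variable `X` on the finite probability space `(Ω, P)`.
Here `P.map X x` is `P(X = x)`, which is nonzero for only finitely many `x`; a value of
probability zero contributes zero. -/
noncomputable def entropy {Ω : Type} [Finite Ω] {α : Type*} (P : PMF Ω) (X : Ω → α) : ℝ :=
  ∑ᶠ x : α, ((P.map X) x).toReal * Real.logb 2 (1 / ((P.map X) x).toReal)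

/-- `h` is entropic: for some random variables `X i`, `i ∈ E`, on one finite probability space,
`h A` is the entropy of the joint variable `X_A = (X i)_{i ∈ A}`, for every `A ⊆ E`. -/
def IsEntropic {E : Type*} (h : Set E → ℝ) : Prop :=
  ∃ (Ω : Type) (_ : Finite Ω) (P : PMF Ω) (α : E → Type) (X : ∀ i : E, Ω → α i),
    ∀ A : Set E, h A = entropy P (fun ω : Ω => fun i : A => X i ω)

/-- A polymatroid of finite type is almost entropic if it is the pointwise limit of a sequence of
entropic polymatroids on the same ground set. -/
structure IsAlmostEntropic {E : Type*} (f : Set E → ℝ) : Prop where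
  isPolymatroid : IsPolymatroid f
  isFiniteType : IsFiniteType f
  exists_limit : ∃ h : ℕ → Set E → ℝ,
    (∀ n, IsPolymatroid (h n) ∧ IsEntropic (h n)) ∧
      ∀ A : Set E, Tendsto (fun n => h n A) atTop (𝓝 (f A))

/-- The structure carried by the generating set of a partial Dowling geometry: an involution and a
distinguished element fixed by it. -/
structure GenStructure (S : Type*) where
  inv : S → S
  e : S
  inv_inv : ∀ s, inv (inv s) = s
  inv_e : inv e = e

/-- Index pairs `i < j`. -/
abbrev IndexPair (r : ℕ) : Type := {p : Fin r × Fin r // p.1 < p.2}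

/-- The element `s_{i,j}` for arbitrary distinct `i, j`, given the elements `s_{i,j}` for `i < j`:
for `j < i` it is `(s⁻¹)_{j,i}`. With this convention the element `s_{i,j}⁻¹` is
`(s⁻¹)_{i,j}`, for `i < j` as well as for `j < i`. -/
def labelled {r : ℕ} {S E : Type*} (σ : GenStructure S) (pt : IndexPair r → S → E)
    (i j : Fin r) (hij : i ≠ j) (s : S) : E :=
  if h : i < j then pt ⟨(i, j), h⟩ s
  else pt ⟨(j, i), lt_of_le_of_ne (not_lt.mp h) hij.symm⟩ (σ.inv s)

/-- A partial Dowling geometry of rank `r` with ground set `E` and generating set `S`. -/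
structure PDG (r : ℕ) {S : Type*} (σ : GenStructure S) (E : Type*) where
  /-- the rank function -/
  rank : Set E → ℝ
  isPolymatroid : IsPolymatroid rank
  /-- the distinguished basis -/
  b : Fin r → E
  /-- the elements `s_{i,j}` for `i < j` -/
  pt : IndexPair r → S → E
  /-- `E` is the disjoint union of the basis and of one copy of `S` for each pair `i < j` -/
  partition : Function.Bijective
    (Sum.elim b (fun q : IndexPair r × S => pt q.1 q.2))
  basis : ∀ A : Set E, A ⊆ Set.range b → rank A = (A.ncard : ℝ)
  frame : ∀ (i j : Fin r) (hij : i ≠ j) (s : S),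
    labelled σ pt i j hij s ∈ polyClosure rank {b i, b j}
  nondegenerate : ∀ (i j : Fin r) (hij : i ≠ j) (s : S),
    rank {labelled σ pt i j hij s} = 1 ∧ rank {b i, labelled σ pt i j hij s} = 2
  coherent : ∀ (i j k : Fin r) (hij : i ≠ j) (hjk : j ≠ k) (hki : k ≠ i) (s : S),
    rank {labelled σ pt i j hij s, labelled σ pt j k hjk (σ.inv s),
      labelled σ pt k i hki σ.e} = 2

/-- The embedding `η` of the ground set of `G` into that of `G'` exhibits `G'` as an extension of
`G`: it preserves the rank of every subset, and it sends each `b_i` to `b_i` and each `s_{i,j}` to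
`s_{i,j}`. -/
structure PDG.IsExtension {r r' : ℕ} (hr : r ≤ r') {S : Type*} {σ : GenStructure S}
    {E E' : Type*} (G : PDG r σ E) (G' : PDG r' σ E') (η : E → E') : Prop where
  injective : Function.Injective η
  rank_image : ∀ A : Set E, G'.rank (η '' A) = G.rank A
  map_b : ∀ i : Fin r, η (G.b i) = G'.b (Fin.castLE hr i)
  map_labelled : ∀ (i j : Fin r) (hij : i ≠ j) (s : S),
    η (labelled σ G.pt i j hij s) =
      labelled σ G'.pt (Fin.castLE hr i) (Fin.castLE hr j)
        ((Fin.castLE_injective hr).ne hij) s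

/-!
The extension is built from copies of the given geometry `G`, without common-information
arguments; the operations used are conditionally independent gluing and contraction.

All constructions take place in the closure of the set of entropic polymatroids in the product
topology of `Set E → ℝ` (`entClosure`). Three operations preserve it. Relabelling of the ground set
is trivial. Two copies of a polymatroid can be glued along any set `Z` of elements so that they are
modular over `Z` (`exists_isCopy`): for random variables this is the coupling of two copies that are
independent conditionally on `X_Z`, and compactness gives the limiting case. An element `c` can be
contracted (`contract_mem_entClosure`): collections of `N` copies of the variables, independent
conditionally on `X_c`, that are revealed only with probability `1 / N`, have entropies that tend to
the conditional entropies `H(X_A | X_c)`. Conversely, on a countable ground set, the finitary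
modification of a polymatroid in this closure is almost entropic (`isAlmostEntropic_finitary`).

Glue two copies of `G` along the line through `b₀` and `b₁`; this gives a second point `b₃` over
`b₂`. Then glue two copies of the result along the plane spanned by `b₀`, `b₂`, `b₃` and the lines
joining `b₀` to `b₂` and `b₃`; this gives a second point `β` over `b₁`. The amalgam
(`exists_isAmalgam`) has rank five, and any choice of one point over each `b_i` is contained in a
copy of `G`. No copy contains both `b₂` and `b₃`, but `β` and `b₃` are joined by a line. Contracting
the neutral element `c` of the line through `β` and `b₂` makes `β` and `b₂` parallel, leaves a
polymatroid of rank four, and does not affect the ranks in the original copy of `G`. The elements on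
the line through `β` and `b₃` then serve as `s_{2,3}`.

It remains to check that `s_{i,j}`, `s_{k,j}` and `e_{k,i}` have rank two. If `{i, j, k}` does not
contain both `2` and `3`, these elements lie in one copy of `G`. For `{0, 2, 3}` they are parallel,
modulo `c`, to elements of the copy of `G` on `b₀`, `β`, `b₃`. For `{1, 2, 3}` no single copy of `G`
suffices. The three elements and `c` lie on the four sides of the quadrangle `b₁`, `b₃`, `β`, `b₂`.
They are spanned by these four points, but also by four suitably labelled elements on the lines that
join `b₀` to these points. Each of the two sets has rank at most
four and their union has rank five, whence by submodularity the three elements and `c` have rank at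
most three (`IsAmalgam.contract_triple_le_of_ne_zero`).
-/

/-! ### Entropy as an average over the sample space -/

/-- The probability that `X` takes the value it has at `ω`, for a weight function `p`. -/
noncomputable def mass {Ω β : Type*} [Fintype Ω] (p : Ω → ℝ) (X : Ω → β) (ω : Ω) : ℝ :=
  open Classical in ∑ ω', if X ω' = X ω then p ω' else 0

/-- Shannon entropy of `X`, written as the expectation of `-log P(X = X ω)`. -/
noncomputable def ent {Ω β : Type*} [Fintype Ω] (p : Ω → ℝ) (X : Ω → β) : ℝ :=
  ∑ ω, p ω * -Real.logb 2 (mass p X ω)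

/-- The weights `p` form a probability distribution. -/
structure IsProb {Ω : Type*} [Fintype Ω] (p : Ω → ℝ) : Prop where
  nonneg : ∀ ω, 0 ≤ p ω
  sum_eq_one : ∑ ω, p ω = 1

section
variable {Ω Ω' β γ δ : Type*} [Fintype Ω] [Fintype Ω'] {p : Ω → ℝ}

theorem le_mass (hp : IsProb p) (X : Ω → β) (ω : Ω) : p ω ≤ mass p X ω := by
  classical
  unfold mass
  have := Finset.single_le_sum (f := fun ω' => if X ω' = X ω then p ω' else 0)
    (fun i _ => by split_ifs <;> simp [hp.nonneg]) (Finset.mem_univ ω)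
  simpa using this

theorem mass_nonneg (hp : IsProb p) (X : Ω → β) (ω : Ω) : 0 ≤ mass p X ω :=
  (hp.nonneg ω).trans (le_mass hp X ω)

theorem mass_congr {X : Ω → β} {Y : Ω → γ} {ω : Ω}
    (h : ∀ ω', X ω' = X ω ↔ Y ω' = Y ω) : mass p X ω = mass p Y ω := by
  classical
  unfold mass
  exact Finset.sum_congr rfl fun ω' _ => by simp only [h ω']

theorem mass_eq_of_eq {X : Ω → β} {ω ω' : Ω} (h : X ω = X ω') : mass p X ω = mass p X ω' := by
  unfold mass; rw [h]

theorem ent_congr {X : Ω → β} {Y : Ω → γ}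
    (h : ∀ ω ω', X ω' = X ω ↔ Y ω' = Y ω) : ent p X = ent p Y := by
  unfold ent
  exact Finset.sum_congr rfl fun ω _ => by rw [mass_congr (h ω)]

theorem mass_anti (hp : IsProb p) {X : Ω → β} {Y : Ω → γ} {ω : Ω}
    (h : ∀ ω', X ω' = X ω → Y ω' = Y ω) : mass p X ω ≤ mass p Y ω := by
  classical
  unfold mass
  refine Finset.sum_le_sum fun ω' _ => ?_
  by_cases h1 : X ω' = X ω
  · simp [h1, h ω' h1]
  · simp only [h1, if_false]; split_ifs <;> simp [hp.nonneg]

theorem ent_mono (hp : IsProb p) {X : Ω → β} {Y : Ω → γ}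
    (h : ∀ ω ω', X ω' = X ω → Y ω' = Y ω) : ent p Y ≤ ent p X := by
  unfold ent
  refine Finset.sum_le_sum fun ω _ => ?_
  rcases (hp.nonneg ω).eq_or_lt with h0 | h0
  · simp [← h0]
  · refine mul_le_mul_of_nonneg_left (neg_le_neg ?_) h0.le
    exact Real.logb_le_logb_of_le one_lt_two (h0.trans_le (le_mass hp X ω)) (mass_anti hp (h ω))

theorem ent_eq_zero_of_const (hp : IsProb p) {X : Ω → β} (h : ∀ ω ω', X ω' = X ω) :
    ent p X = 0 := by
  unfold ent
  refine Finset.sum_eq_zero fun ω _ => ?_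
  have : mass p X ω = 1 := by unfold mass; simp [h ω, hp.sum_eq_one]
  simp [this]

/-- The conditional probabilities given `V`, summed over a part of a single fibre of `V`, add up to
at most one. -/
theorem sum_div_mass_le_one (hp : IsProb p) (V : Ω → δ) (s : Ω → Prop) [DecidablePred s]
    (hs : ∀ ω ω', s ω → s ω' → V ω' = V ω) :
    ∑ ω, (if s ω then p ω / mass p V ω else 0) ≤ 1 := by
  classical
  by_cases hne : ∃ ω₀, s ω₀
  · obtain ⟨ω₀, h₀⟩ := hne
    calc ∑ ω, (if s ω then p ω / mass p V ω else 0)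
        ≤ ∑ ω, (if V ω = V ω₀ then p ω else 0) / mass p V ω₀ := by
          refine Finset.sum_le_sum fun ω _ => ?_
          by_cases h1 : s ω
          · rw [if_pos h1, if_pos (hs _ _ h₀ h1), mass_eq_of_eq (hs _ _ h₀ h1)]
          · rw [if_neg h1]
            refine div_nonneg ?_ (mass_nonneg hp _ _)
            split_ifs <;> simp [hp.nonneg]
      _ = mass p V ω₀ / mass p V ω₀ := by rw [← Finset.sum_div]; rfl
      _ ≤ 1 := div_self_le_one _
  · push Not at hne
    simp [hne]

/-- Submodularity of entropy: `V` is the joint variable of `X` and `Y`, and `W` is a function of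
`X` as well as of `Y`. -/
theorem ent_submodular (hp : IsProb p) {α : Type*} {X : Ω → β} {Y : Ω → γ} {V : Ω → δ} {W : Ω → α}
    (hV : ∀ ω ω', V ω' = V ω ↔ X ω' = X ω ∧ Y ω' = Y ω)
    (hX : ∀ ω ω', X ω' = X ω → W ω' = W ω) (hY : ∀ ω ω', Y ω' = Y ω → W ω' = W ω) :
    ent p V + ent p W ≤ ent p X + ent p Y := by
  classical
  -- by `log x ≤ x - 1` it suffices to bound the expectation of the density ratio by one
  have key : ∑ ω, p ω * (mass p X ω * mass p Y ω / (mass p V ω * mass p W ω)) ≤ 1 := by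
    have h1 : ∀ ω, p ω * (mass p X ω * mass p Y ω / (mass p V ω * mass p W ω)) =
        ∑ ω₁, ∑ ω₂, (if X ω₁ = X ω ∧ Y ω₂ = Y ω then p ω / mass p V ω else 0) *
          (p ω₁ * p ω₂ * (if W ω₂ = W ω₁ then (mass p W ω₁)⁻¹ else 0)) := by
      intro ω
      have : mass p X ω * mass p Y ω = ∑ ω₁, ∑ ω₂,
          (if X ω₁ = X ω then p ω₁ else 0) * (if Y ω₂ = Y ω then p ω₂ else 0) := by
        rw [mass, mass, Finset.sum_mul_sum]
      have h2 : p ω * (mass p X ω * mass p Y ω / (mass p V ω * mass p W ω)) =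
        (mass p X ω * mass p Y ω) * (p ω / mass p V ω * (mass p W ω)⁻¹) := by
          simp only [div_eq_mul_inv, mul_inv]; ring
      rw [h2, this, Finset.sum_mul]
      refine Finset.sum_congr rfl fun ω₁ _ => ?_
      rw [Finset.sum_mul]
      refine Finset.sum_congr rfl fun ω₂ _ => ?_
      by_cases hx : X ω₁ = X ω
      · by_cases hy : Y ω₂ = Y ω
        · have hw1 := hX _ _ hx
          have hw2 := hY _ _ hy
          rw [if_pos hx, if_pos hy, if_pos ⟨hx, hy⟩, if_pos (hw2.trans hw1.symm),
            mass_eq_of_eq hw1]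
          ring
        · simp [hy]
      · simp [hx]
    calc _ = ∑ ω₁, ∑ ω₂, (∑ ω, if X ω₁ = X ω ∧ Y ω₂ = Y ω then p ω / mass p V ω else 0) *
          (p ω₁ * p ω₂ * (if W ω₂ = W ω₁ then (mass p W ω₁)⁻¹ else 0)) := by
          simp_rw [h1, Finset.sum_mul]
          rw [Finset.sum_comm]
          refine Finset.sum_congr rfl fun ω₁ _ => ?_
          rw [Finset.sum_comm]
      _ ≤ ∑ ω₁, ∑ ω₂, 1 *
          (p ω₁ * p ω₂ * (if W ω₂ = W ω₁ then (mass p W ω₁)⁻¹ else 0)) := by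
          refine Finset.sum_le_sum fun ω₁ _ => Finset.sum_le_sum fun ω₂ _ => ?_
          refine mul_le_mul_of_nonneg_right (sum_div_mass_le_one hp V _ ?_) ?_
          · rintro ω ω' ⟨h1, h2⟩ ⟨h3, h4⟩
            exact (hV _ _).2 ⟨h3.symm.trans h1, h4.symm.trans h2⟩
          · refine mul_nonneg (mul_nonneg (hp.nonneg _) (hp.nonneg _)) ?_
            split_ifs
            · exact inv_nonneg.2 (mass_nonneg hp _ _)
            · exact le_rfl
      _ = ∑ ω₁, p ω₁ * (mass p W ω₁ * (mass p W ω₁)⁻¹) := by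
          refine Finset.sum_congr rfl fun ω₁ _ => ?_
          conv_rhs => rw [mass, Finset.sum_mul, Finset.mul_sum]
          refine Finset.sum_congr rfl fun ω₂ _ => ?_
          by_cases hw : W ω₂ = W ω₁
          · simp only [hw, if_true]; rw [one_mul, mul_assoc]; rfl
          · simp [hw]
      _ ≤ ∑ ω₁, p ω₁ := by
          refine Finset.sum_le_sum fun ω₁ _ => ?_
          exact mul_le_of_le_one_right (hp.nonneg _) mul_inv_le_one
      _ = 1 := hp.sum_eq_one
  have hlog : ∀ ω, p ω * -Real.logb 2 (mass p V ω) + p ω * -Real.logb 2 (mass p W ω)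
      ≤ p ω * -Real.logb 2 (mass p X ω) + p ω * -Real.logb 2 (mass p Y ω) +
        (p ω * (mass p X ω * mass p Y ω / (mass p V ω * mass p W ω)) - p ω) / Real.log 2 := by
    intro ω
    rcases (hp.nonneg ω).eq_or_lt with h0 | h0
    · simp [← h0]
    have hx := h0.trans_le (le_mass hp X ω)
    have hy := h0.trans_le (le_mass hp Y ω)
    have hv := h0.trans_le (le_mass hp V ω)
    have hw := h0.trans_le (le_mass hp W ω)
    have := Real.log_le_sub_one_of_pos (x := mass p X ω * mass p Y ω / (mass p V ω * mass p W ω))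
      (by positivity)
    rw [Real.log_div (by positivity) (by positivity), Real.log_mul hx.ne' hy.ne',
      Real.log_mul hv.ne' hw.ne'] at this
    have h2 : 0 < Real.log 2 := Real.log_pos one_lt_two
    simp only [Real.logb]
    have h3 := mul_le_mul_of_nonneg_left this (div_nonneg h0.le h2.le)
    have e1 : p ω / Real.log 2 * (Real.log (mass p X ω) + Real.log (mass p Y ω) -
      (Real.log (mass p V ω) + Real.log (mass p W ω))) =
      p ω * (Real.log (mass p X ω) / Real.log 2) + p ω * (Real.log (mass p Y ω) / Real.log 2)
      - p ω * (Real.log (mass p V ω) / Real.log 2)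
      - p ω * (Real.log (mass p W ω) / Real.log 2) := by
        ring
    have e2 : p ω / Real.log 2 * (mass p X ω * mass p Y ω / (mass p V ω * mass p W ω) - 1) =
      (p ω * (mass p X ω * mass p Y ω / (mass p V ω * mass p W ω)) - p ω) / Real.log 2 := by ring
    rw [e1, e2] at h3
    linarith
  have hsum := Finset.sum_le_sum fun ω (_ : ω ∈ Finset.univ) => hlog ω
  simp only [Finset.sum_add_distrib] at hsum
  rw [← Finset.sum_div, Finset.sum_sub_distrib, hp.sum_eq_one] at hsum
  have : (∑ ω, p ω * (mass p X ω * mass p Y ω / (mass p V ω * mass p W ω)) - 1) / Real.log 2 ≤ 0 :=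
    div_nonpos_of_nonpos_of_nonneg (by linarith) (Real.log_nonneg one_le_two)
  unfold ent
  linarith

theorem mass_comp {q : Ω' → ℝ} (π : Ω' → Ω)
    (hπ : open Classical in ∀ ω, ∑ ω', (if π ω' = ω then q ω' else 0) = p ω) (X : Ω → β) (ω' : Ω') :
    mass q (X ∘ π) ω' = mass p X (π ω') := by
  classical
  unfold mass
  simp_rw [← hπ, ← Finset.sum_filter (fun a => X a = X (π ω'))]
  rw [Finset.sum_comm]
  refine Finset.sum_congr rfl fun a _ => ?_
  simp [Finset.sum_ite_eq, Finset.mem_filter]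

theorem sum_comp_weight {q : Ω' → ℝ} (π : Ω' → Ω)
    (hπ : open Classical in ∀ ω, ∑ ω', (if π ω' = ω then q ω' else 0) = p ω) (F : Ω → ℝ) :
    ∑ ω', q ω' * F (π ω') = ∑ ω, p ω * F ω := by
  classical
  simp_rw [← hπ, Finset.sum_mul]
  rw [Finset.sum_comm]
  refine Finset.sum_congr rfl fun a _ => ?_
  simp

/-- The entropy depends only on the law: if `π` pushes the weights `q` forward to `p`, it may be
computed with respect to either. -/
theorem ent_comp {q : Ω' → ℝ} (π : Ω' → Ω)
    (hπ : open Classical in ∀ ω, ∑ ω', (if π ω' = ω then q ω' else 0) = p ω) (X : Ω → β) :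
    ent q (X ∘ π) = ent p X := by
  unfold ent
  simp_rw [mass_comp π hπ X]
  exact sum_comp_weight π hπ fun ω => -Real.logb 2 (mass p X ω)

end

theorem isProb_toReal {Ω : Type*} [Fintype Ω] (P : PMF Ω) : IsProb fun ω => (P ω).toReal := by
  refine ⟨fun _ => ENNReal.toReal_nonneg, ?_⟩
  have h := P.tsum_coe
  rw [tsum_fintype] at h
  rw [← ENNReal.toReal_sum fun ω _ => P.apply_ne_top ω, h, ENNReal.toReal_one]

theorem entropy_eq_ent {Ω : Type} [Fintype Ω] {α : Type*} (P : PMF Ω) (X : Ω → α) :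
    entropy P X = ent (fun ω => (P ω).toReal) X := by
  classical
  have hm : ∀ x, ((P.map X) x).toReal = ∑ ω, if X ω = x then (P ω).toReal else 0 := by
    intro x
    rw [PMF.map_apply, tsum_fintype, ENNReal.toReal_sum]
    · refine Finset.sum_congr rfl fun ω _ => ?_
      by_cases h : X ω = x
      · simp [h]
      · simp [h, Ne.symm h]
    · intro ω _; split_ifs
      · exact P.apply_ne_top ω
      · simp
  unfold entropy ent
  rw [finsum_eq_sum_of_support_subset (s := Finset.univ.image X)]
  · simp_rw [hm, Finset.sum_mul]
    rw [Finset.sum_comm]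
    refine Finset.sum_congr rfl fun ω _ => ?_
    rw [Finset.sum_eq_single (X ω)]
    · simp [mass, Real.logb_inv]
    · intro b _ hb
      simp [hb.symm]
    · intro h; simp at h
  · intro x hx
    rw [Function.mem_support, hm] at hx
    by_contra hne
    apply hx
    rw [Finset.sum_eq_zero, zero_mul]
    intro ω _
    rw [if_neg]
    rintro rfl
    exact hne (by simp)

/-! ### Entropic polymatroids -/

section
variable {E : Type*} {Ω : Type*} {α : E → Type*}

/-- The joint variable `(X i)_{i ∈ A}`. -/
def joint (X : ∀ i : E, Ω → α i) (A : Set E) (ω : Ω) : ∀ i : A, α i := fun i => X i ω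

theorem joint_eq_iff {X : ∀ i : E, Ω → α i} {A : Set E} {ω ω' : Ω} :
    joint X A ω = joint X A ω' ↔ ∀ i ∈ A, X i ω = X i ω' := by
  simp [joint, funext_iff]

end

theorem isEntropic_iff {E : Type*} {h : Set E → ℝ} :
    IsEntropic h ↔ ∃ (Ω : Type) (_ : Fintype Ω) (p : Ω → ℝ) (_ : IsProb p) (α : E → Type)
      (X : ∀ i : E, Ω → α i), ∀ A : Set E, h A = ent p (joint X A) := by
  constructor
  · rintro ⟨Ω, _, P, α, X, hX⟩
    have := Fintype.ofFinite Ω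
    refine ⟨Ω, this, _, isProb_toReal P, α, X, fun A => ?_⟩
    rw [hX, entropy_eq_ent]; rfl
  · rintro ⟨Ω, _, p, hp, α, X, hX⟩
    have hs : ∑ ω, ENNReal.ofReal (p ω) = 1 := by
      rw [← ENNReal.ofReal_sum_of_nonneg fun ω _ => hp.nonneg ω, hp.sum_eq_one, ENNReal.ofReal_one]
    refine ⟨Ω, inferInstance, PMF.ofFintype (fun ω => ENNReal.ofReal (p ω)) hs, α, X, fun A => ?_⟩
    rw [hX, entropy_eq_ent]
    simp only [PMF.ofFintype_apply, ENNReal.toReal_ofReal (hp.nonneg _)]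
    rfl

theorem IsEntropic.isPolymatroid {E : Type*} {h : Set E → ℝ} (hh : IsEntropic h) :
    IsPolymatroid h := by
  obtain ⟨Ω, _, p, hp, α, X, hX⟩ := isEntropic_iff.1 hh
  refine ⟨?_, fun A B hAB => ?_, fun A B => ?_⟩
  · rw [hX]
    exact ent_eq_zero_of_const hp fun ω ω' => by simp [joint_eq_iff]
  · rw [hX, hX]
    refine ent_mono hp fun ω ω' => ?_
    rw [joint_eq_iff, joint_eq_iff]
    exact fun h i hi => h i (hAB hi)
  · simp only [hX]
    refine ent_submodular hp (fun ω ω' => ?_) (fun ω ω' => ?_) fun ω ω' => ?_ <;>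
      simp only [joint_eq_iff, Set.mem_union, Set.mem_inter_iff]
    · constructor
      · exact fun h => ⟨fun i hi => h i (.inl hi), fun i hi => h i (.inr hi)⟩
      · rintro ⟨h1, h2⟩ i (hi | hi)
        exacts [h1 i hi, h2 i hi]
    · exact fun h i hi => h i hi.1
    · exact fun h i hi => h i hi.2

/-! ### Conditionally independent coupling -/

section
variable {Ω Ω₁ Ω₂ β β' γ : Type*} [Fintype Ω] [Fintype Ω₁]

/-- Variables with the same fibres up to null sets have the same entropy. -/
theorem ent_congr_support {p : Ω → ℝ} {X : Ω → β} {Y : Ω → γ}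
    (h : ∀ ω ω', p ω ≠ 0 → p ω' ≠ 0 → (X ω' = X ω ↔ Y ω' = Y ω)) : ent p X = ent p Y := by
  classical
  unfold ent
  refine Finset.sum_congr rfl fun ω _ => ?_
  by_cases h0 : p ω = 0
  · simp [h0]
  have : mass p X ω = mass p Y ω := by
    unfold mass
    refine Finset.sum_congr rfl fun ω' _ => ?_
    by_cases h1 : p ω' = 0
    · simp [h1]
    · simp only [h ω ω' h0 h1]
  rw [this]

/-- The variables `W₁` and `W₂`, on possibly different probability spaces, have the same law. -/
def SameLaw [Fintype Ω₂] (p₁ : Ω₁ → ℝ) (p₂ : Ω₂ → ℝ) (W₁ : Ω₁ → γ) (W₂ : Ω₂ → γ) : Prop :=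
  open Classical in
  ∀ w, ∑ ω, (if W₁ ω = w then p₁ ω else 0) = ∑ ω, (if W₂ ω = w then p₂ ω else 0)

/-- The weights on `Ω₁ × Ω₂` that make the two coordinates independent conditionally on the common
value of `W₁` and `W₂`. -/
noncomputable def coupling (p₁ : Ω₁ → ℝ) (p₂ : Ω₂ → ℝ) (W₁ : Ω₁ → γ) (W₂ : Ω₂ → γ)
    (ω : Ω₁ × Ω₂) : ℝ :=
  open Classical in if W₂ ω.2 = W₁ ω.1 then p₁ ω.1 * p₂ ω.2 / mass p₁ W₁ ω.1 else 0

variable {p₁ : Ω₁ → ℝ} {p₂ : Ω₂ → ℝ} {W₁ : Ω₁ → γ} {W₂ : Ω₂ → γ}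

theorem eq_of_coupling_ne_zero {ω : Ω₁ × Ω₂} (h : coupling p₁ p₂ W₁ W₂ ω ≠ 0) :
    W₂ ω.2 = W₁ ω.1 := by
  by_contra hne
  exact h (by simp [coupling, hne])

variable [Fintype Ω₂]

theorem SameLaw.mass_eq (hW : SameLaw p₁ p₂ W₁ W₂) {ω₁ : Ω₁} {ω₂ : Ω₂} (h : W₂ ω₂ = W₁ ω₁) :
    mass p₁ W₁ ω₁ = mass p₂ W₂ ω₂ := by
  unfold mass; rw [h]; exact hW _

theorem coupling_nonneg (hp₁ : IsProb p₁) (hp₂ : IsProb p₂) (ω : Ω₁ × Ω₂) :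
    0 ≤ coupling p₁ p₂ W₁ W₂ ω := by
  unfold coupling
  split_ifs
  · exact div_nonneg (mul_nonneg (hp₁.nonneg _) (hp₂.nonneg _)) (mass_nonneg hp₁ _ _)
  · exact le_rfl

theorem IsProb.mul_mass_div {p : Ω → ℝ} (hp : IsProb p) (X : Ω → β) (ω : Ω) :
    p ω * mass p X ω / mass p X ω = p ω := by
  rcases (mass_nonneg hp X ω).eq_or_lt with h | h
  · have : p ω = 0 := le_antisymm (h ▸ le_mass hp X ω) (hp.nonneg ω)
    simp [this]
  · exact mul_div_cancel_right₀ _ h.ne'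

theorem coupling_fst (hp₁ : IsProb p₁) (hW : SameLaw p₁ p₂ W₁ W₂) (ω₁ : Ω₁) :
    open Classical in
    ∑ ω : Ω₁ × Ω₂, (if ω.1 = ω₁ then coupling p₁ p₂ W₁ W₂ ω else 0) = p₁ ω₁ := by
  classical
  rw [Fintype.sum_prod_type, Finset.sum_eq_single ω₁]
  · simp only [if_true, coupling]
    have := hW (W₁ ω₁)
    calc _ = ∑ ω₂, p₁ ω₁ / mass p₁ W₁ ω₁ * (if W₂ ω₂ = W₁ ω₁ then p₂ ω₂ else 0) := by
          refine Finset.sum_congr rfl fun ω₂ _ => ?_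
          split_ifs <;> ring
      _ = p₁ ω₁ / mass p₁ W₁ ω₁ * mass p₁ W₁ ω₁ := by
          rw [← Finset.mul_sum, ← this]; rfl
      _ = p₁ ω₁ := by rw [div_mul_eq_mul_div, hp₁.mul_mass_div]
  · intro b _ hb
    simp [hb]
  · intro h; simp at h

theorem coupling_snd (hp₂ : IsProb p₂) (hW : SameLaw p₁ p₂ W₁ W₂) (ω₂ : Ω₂) :
    open Classical in
    ∑ ω : Ω₁ × Ω₂, (if ω.2 = ω₂ then coupling p₁ p₂ W₁ W₂ ω else 0) = p₂ ω₂ := by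
  classical
  rw [Fintype.sum_prod_type_right, Finset.sum_eq_single ω₂]
  · simp only [if_true, coupling]
    have := hW (W₂ ω₂)
    calc _ = ∑ ω₁, p₂ ω₂ / mass p₂ W₂ ω₂ * (if W₁ ω₁ = W₂ ω₂ then p₁ ω₁ else 0) := by
          refine Finset.sum_congr rfl fun ω₁ _ => ?_
          by_cases h : W₂ ω₂ = W₁ ω₁
          · rw [if_pos h, if_pos h.symm, hW.mass_eq h]; ring
          · rw [if_neg h, if_neg (Ne.symm h)]; ring
      _ = p₂ ω₂ / mass p₂ W₂ ω₂ * mass p₂ W₂ ω₂ := by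
          rw [← Finset.mul_sum, this]; rfl
      _ = p₂ ω₂ := by rw [div_mul_eq_mul_div, hp₂.mul_mass_div]
  · intro b _ hb
    simp [hb]
  · intro h; simp at h

theorem isProb_coupling (hp₁ : IsProb p₁) (hp₂ : IsProb p₂) (hW : SameLaw p₁ p₂ W₁ W₂) :
    IsProb (coupling p₁ p₂ W₁ W₂) := by
  classical
  refine ⟨coupling_nonneg hp₁ hp₂, ?_⟩
  rw [← hp₁.sum_eq_one, ← Finset.sum_congr rfl fun ω _ => coupling_fst hp₁ hW ω, Finset.sum_comm]
  simp

/-- The entropy of a conditionally independent pair, each member of which determines the variable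
conditioned upon. -/
theorem ent_coupling (hp₁ : IsProb p₁) (hp₂ : IsProb p₂) (hW : SameLaw p₁ p₂ W₁ W₂)
    {X : Ω₁ → β} {Y : Ω₂ → β'} (hX : ∀ ω ω', X ω' = X ω → W₁ ω' = W₁ ω)
    (hY : ∀ ω ω', Y ω' = Y ω → W₂ ω' = W₂ ω) :
    ent (coupling p₁ p₂ W₁ W₂) (fun ω => (X ω.1, Y ω.2)) = ent p₁ X + ent p₂ Y - ent p₁ W₁ := by
  classical
  have hm : ∀ ω : Ω₁ × Ω₂, W₂ ω.2 = W₁ ω.1 →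
      mass (coupling p₁ p₂ W₁ W₂) (fun ω => (X ω.1, Y ω.2)) ω =
        mass p₁ X ω.1 * mass p₂ Y ω.2 / mass p₁ W₁ ω.1 := by
    intro ω hω
    rw [mass, mass, mass, Finset.sum_mul_sum, Fintype.sum_prod_type, Finset.sum_div]
    refine Finset.sum_congr rfl fun ω₁ _ => ?_
    rw [Finset.sum_div]
    refine Finset.sum_congr rfl fun ω₂ _ => ?_
    by_cases h1 : X ω₁ = X ω.1
    · by_cases h2 : Y ω₂ = Y ω.2
      · have h3 := hX _ _ h1
        have h4 := hY _ _ h2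
        simp [h1, h2, coupling, h4, hω, h3, mass_eq_of_eq h3]
      · simp [h2]
    · simp [h1]
  have e1 := sum_comp_weight (p := p₁) (q := coupling p₁ p₂ W₁ W₂) Prod.fst (coupling_fst hp₁ hW)
    fun ω => -Real.logb 2 (mass p₁ X ω)
  have e2 := sum_comp_weight (p := p₂) (q := coupling p₁ p₂ W₁ W₂) Prod.snd (coupling_snd hp₂ hW)
    fun ω => -Real.logb 2 (mass p₂ Y ω)
  have e3 := sum_comp_weight (p := p₁) (q := coupling p₁ p₂ W₁ W₂) Prod.fst (coupling_fst hp₁ hW)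
    fun ω => -Real.logb 2 (mass p₁ W₁ ω)
  simp only [ent]
  rw [← e1, ← e2, ← e3, ← Finset.sum_add_distrib, ← Finset.sum_sub_distrib]
  refine Finset.sum_congr rfl fun ω _ => ?_
  by_cases h0 : coupling p₁ p₂ W₁ W₂ ω = 0
  · simp [h0]
  have hω := eq_of_coupling_ne_zero h0
  have hne : p₁ ω.1 ≠ 0 ∧ p₂ ω.2 ≠ 0 := by
    constructor <;> intro h <;> exact h0 (by simp [coupling, h])
  have hx := ((hp₁.nonneg _).lt_of_ne' hne.1).trans_le (le_mass hp₁ X ω.1)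
  have hy := ((hp₂.nonneg _).lt_of_ne' hne.2).trans_le (le_mass hp₂ Y ω.2)
  have hw := ((hp₁.nonneg _).lt_of_ne' hne.1).trans_le (le_mass hp₁ W₁ ω.1)
  rw [hm ω hω, Real.logb_div (mul_pos hx hy).ne' hw.ne', Real.logb_mul hx.ne' hy.ne']
  ring

end

/-! ### Copies of entropic polymatroids -/

/-- The second embedding of `E` into two copies of `E` that are glued along `Z`: the elements of
`Z` are taken from the first copy, the others from the second. -/
noncomputable def glue {E : Type*} (Z : Set E) (x : E) : E ⊕ E :=
  open Classical in if x ∈ Z then Sum.inl x else Sum.inr x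

theorem glue_of_mem {E : Type*} {Z : Set E} {x : E} (h : x ∈ Z) : glue Z x = Sum.inl x := by
  simp [glue, h]

theorem glue_of_notMem {E : Type*} {Z : Set E} {x : E} (h : x ∉ Z) : glue Z x = Sum.inr x := by
  simp [glue, h]

/-- The polymatroid `g` consists of two copies of `h`, glued along `Z` in such a way that they are
modular over `Z`. -/
structure IsCopy {E : Type*} (h : Set E → ℝ) (Z : Set E) (g : Set (E ⊕ E) → ℝ) : Prop where
  left : ∀ A, g (Sum.inl '' A) = h A
  right : ∀ A, g (Sum.inr '' A) = h A
  glued : ∀ A, g (glue Z '' A) = h A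
  modular : ∀ A B, Z ⊆ A → Z ⊆ B → g (Sum.inl '' A ∪ glue Z '' B) = h A + h B - h Z

theorem IsEntropic.exists_isCopy {E : Type*} {h : Set E → ℝ} (hh : IsEntropic h) (Z : Set E) :
    ∃ g, IsEntropic g ∧ IsCopy h Z g := by
  obtain ⟨Ω, _, p, hp, α, X, hX⟩ := isEntropic_iff.1 hh
  have hW : SameLaw p p (joint X Z) (joint X Z) := fun _ => rfl
  let q := coupling p p (joint X Z) (joint X Z)
  let X' : ∀ x : E ⊕ E, Ω × Ω → α (Sum.elim id id x) := fun x =>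
    match x with
    | Sum.inl i => fun ω => X i ω.1
    | Sum.inr i => fun ω => X i ω.2
  have hglue : ∀ (A : Set E) (ω ω' : Ω × Ω), q ω ≠ 0 → q ω' ≠ 0 →
      ((∀ x ∈ glue Z '' A, X' x ω' = X' x ω) ↔ ∀ i ∈ A, X i ω'.2 = X i ω.2) := by
    intro A ω ω' h0 h0'
    have e := joint_eq_iff.1 (eq_of_coupling_ne_zero h0)
    have e' := joint_eq_iff.1 (eq_of_coupling_ne_zero h0')
    rw [Set.forall_mem_image]
    refine forall₂_congr fun i _ => ?_
    by_cases hi : i ∈ Z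
    · rw [glue_of_mem hi, e i hi, e' i hi]; exact Iff.rfl
    · rw [glue_of_notMem hi]; exact Iff.rfl
  refine ⟨fun A => ent q (joint X' A), isEntropic_iff.2
    ⟨Ω × Ω, inferInstance, q, isProb_coupling hp hp hW, _, X', fun A => rfl⟩,
    ⟨fun A => ?_, fun A => ?_, fun A => ?_, fun A B hA hB => ?_⟩⟩
  · rw [hX, ← ent_comp (q := q) Prod.fst (coupling_fst hp hW)]
    refine ent_congr fun ω ω' => ?_
    simp only [Function.comp, joint_eq_iff, Set.forall_mem_image, X']
    exact Iff.rfl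
  · rw [hX, ← ent_comp (q := q) Prod.snd (coupling_snd hp hW)]
    refine ent_congr fun ω ω' => ?_
    simp only [Function.comp, joint_eq_iff, Set.forall_mem_image, X']
    exact Iff.rfl
  · rw [hX, ← ent_comp (q := q) Prod.snd (coupling_snd hp hW)]
    refine ent_congr_support fun ω ω' h0 h0' => ?_
    rw [Function.comp, Function.comp, joint_eq_iff, joint_eq_iff, hglue A ω ω' h0 h0']
  · rw [hX, hX, hX, ← ent_coupling hp hp hW]
    · refine ent_congr_support fun ω ω' h0 h0' => ?_
      rw [Prod.mk.injEq, joint_eq_iff, joint_eq_iff, joint_eq_iff, ← hglue B ω ω' h0 h0']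
      constructor
      · exact fun h => ⟨fun i hi => h (Sum.inl i) (.inl ⟨i, hi, rfl⟩), fun x hx => h x (.inr hx)⟩
      · rintro ⟨h1, h2⟩ x (⟨i, hi, rfl⟩ | hx)
        exacts [h1 i hi, h2 x hx]
    · exact fun ω ω' h => joint_eq_iff.2 fun i hi => joint_eq_iff.1 h i (hA hi)
    · exact fun ω ω' h => joint_eq_iff.2 fun i hi => joint_eq_iff.1 h i (hB hi)

/-! ### Masking and contraction -/

/-- Revealing the variables only when an independent coin of bias `t` shows heads scales the
entropies by `t`, up to the entropy of the coin. -/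
theorem IsEntropic.mask {E : Type*} {h : Set E → ℝ} (hh : IsEntropic h) {t : ℝ} (h0 : 0 ≤ t)
    (h1 : t ≤ 1) :
    IsEntropic (open Classical in fun A => if A = ∅ then 0 else
      t * h A + Real.binEntropy t / Real.log 2) := by
  classical
  obtain ⟨Ω, _, p, hp, α, X, hX⟩ := isEntropic_iff.1 hh
  let q : Option Ω → ℝ := fun o => o.elim (1 - t) fun ω => t * p ω
  have hq : IsProb q := by
    refine ⟨fun o => ?_, ?_⟩
    · cases o
      · exact sub_nonneg.2 h1
      · exact mul_nonneg h0 (hp.nonneg _)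
    · simp [Fintype.sum_option, q, ← Finset.mul_sum, hp.sum_eq_one]
  refine isEntropic_iff.2 ⟨Option Ω, inferInstance, q, hq, fun i => Option (α i),
    fun i o => o.map (X i), fun A => ?_⟩
  split_ifs with hA
  · subst hA
    exact (ent_eq_zero_of_const hq fun ω ω' => by simp [joint_eq_iff]).symm
  obtain ⟨a, ha⟩ := Set.nonempty_iff_ne_empty.2 hA
  have hn : mass q (joint (fun i (o : Option Ω) => o.map (X i)) A) none = 1 - t := by
    rw [mass, Fintype.sum_option, Finset.sum_eq_zero]
    · simp [q]
    · intro ω _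
      rw [if_neg]
      intro h
      simpa using joint_eq_iff.1 h a ha
  have hs : ∀ ω, mass q (joint (fun i (o : Option Ω) => o.map (X i)) A) (some ω) =
      t * mass p (joint X A) ω := by
    intro ω
    rw [mass, Fintype.sum_option, if_neg, zero_add, mass, Finset.mul_sum]
    · refine Finset.sum_congr rfl fun ω' _ => ?_
      simp only [joint_eq_iff, Option.map_some, Option.some_inj, q, Option.elim, mul_ite, mul_zero]
    · intro h
      simpa using joint_eq_iff.1 h a ha
  rw [ent, Fintype.sum_option, hn]
  simp_rw [hs]
  rw [hX, ent, Real.binEntropy_eq_negMulLog_add_negMulLog_one_sub, Finset.mul_sum]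
  have : ∀ ω, q (some ω) * -Real.logb 2 (t * mass p (joint X A) ω) =
      t * (p ω * -Real.logb 2 (mass p (joint X A) ω)) + p ω * (Real.negMulLog t / Real.log 2) := by
    intro ω
    simp only [q, Option.elim]
    rcases (hp.nonneg ω).eq_or_lt with hz | hz
    · simp [← hz]
    rcases h0.eq_or_lt with ht | ht
    · simp [← ht]
    rw [Real.logb_mul ht.ne' (hz.trans_le (le_mass hp _ _)).ne', Real.negMulLog, Real.logb,
      Real.logb]
    ring
  simp_rw [this]
  rw [Finset.sum_add_distrib, ← Finset.sum_mul, hp.sum_eq_one]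
  simp only [q, Option.elim, Real.negMulLog, Real.logb]
  ring

/-- Copies of the `X i` that are independent conditionally on `W`: the conditional entropies of
the collections of `N` copies are `N` times the original ones. -/
theorem exists_conditional_copies {E : Type*} {Ω γ : Type} [Fintype Ω] {p : Ω → ℝ} (hp : IsProb p)
    {α : E → Type} (X : ∀ i, Ω → α i) (W : Ω → γ) (N : ℕ) :
    ∃ (Ω' : Type) (_ : Fintype Ω') (p' : Ω' → ℝ) (α' : E → Type) (X' : ∀ i, Ω' → α' i)
      (W' : Ω' → γ), IsProb p' ∧ SameLaw p' p W' W ∧ ∀ A : Set E,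
        ent p' (fun ω => (joint X' A ω, W' ω)) =
          ent p W + N * (ent p (fun ω => (joint X A ω, W ω)) - ent p W) := by
  induction N with
  | zero =>
    refine ⟨Ω, inferInstance, p, fun _ => Unit, fun _ _ => (), W, hp, fun _ => rfl, fun A => ?_⟩
    rw [Nat.cast_zero, zero_mul, add_zero]
    refine ent_congr fun ω ω' => ?_
    simp [joint_eq_iff]
  | succ N ih =>
    obtain ⟨Ω', _, p', α', X', W', hp', hW, hX'⟩ := ih
    have hWent : ent p' W' = ent p W := by
      have := hX' ∅
      have e : ∀ {Ω : Type} [Fintype Ω] {p : Ω → ℝ} {α : E → Type} (X : ∀ i, Ω → α i) (W : Ω → γ),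
          ent p (fun ω => (joint X ∅ ω, W ω)) = ent p W := fun X W => ent_congr fun ω ω' => by
        rw [Prod.mk.injEq, joint_eq_iff]; simp
      rw [e, e] at this
      simpa using this
    refine ⟨Ω' × Ω, inferInstance, coupling p' p W' W, fun i => α' i × α i,
      fun i ω => (X' i ω.1, X i ω.2), fun ω => W' ω.1, isProb_coupling hp' hp hW, ?_, fun A => ?_⟩
    · intro w
      classical
      rw [← hW w]
      have := sum_comp_weight Prod.fst (coupling_fst hp' hW)
        fun ω => if W' ω = w then (1 : ℝ) else 0
      simpa only [mul_ite, mul_one, mul_zero] using this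
    · have := ent_coupling hp' hp hW (X := fun ω => (joint X' A ω, W' ω))
        (Y := fun ω => (joint X A ω, W ω)) (fun ω ω' h => (Prod.mk.inj h).2)
        (fun ω ω' h => (Prod.mk.inj h).2)
      rw [hX' A, hWent] at this
      push_cast
      rw [show ent p W + (N + 1) * (ent p (fun ω => (joint X A ω, W ω)) - ent p W) =
        ent p W + N * (ent p (fun ω => (joint X A ω, W ω)) - ent p W) +
          ent p (fun ω => (joint X A ω, W ω)) - ent p W by ring, ← this]
      refine ent_congr_support fun ω ω' h0 h0' => ?_
      simp only [Prod.mk.injEq, joint_eq_iff, eq_of_coupling_ne_zero h0,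
        eq_of_coupling_ne_zero h0']
      constructor
      · rintro ⟨h1, h2⟩
        exact ⟨⟨fun i hi => (h1 i hi).1, h2⟩, fun i hi => (h1 i hi).2, h2⟩
      · rintro ⟨⟨h1, h2⟩, h3, -⟩
        exact ⟨fun i hi => ⟨h1 i hi, h3 i hi⟩, h2⟩

/-- The contraction of an entropic polymatroid averages conditional entropies and need not be
entropic. It is a limit of entropic polymatroids: `N` conditionally independent copies, revealed
with probability `1 / N`, have entropy `H(X_A | X_c)` up to `H(X_c) / N` and the entropy of a coin
of bias `1 / N`. -/
theorem IsEntropic.contract_mem_closure {E : Type*} {h : Set E → ℝ} (hh : IsEntropic h) (c : E) :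
    (fun A => h (insert c A) - h {c}) ∈ closure {h : Set E → ℝ | IsEntropic h} := by
  classical
  obtain ⟨Ω, _, p, hp, α, X, hX⟩ := isEntropic_iff.1 hh
  have hc : ent p (X c) = h {c} := by
    rw [hX]; exact ent_congr fun ω ω' => by simp [joint_eq_iff]
  have hA : ∀ A, ent p (fun ω => (joint X A ω, X c ω)) = h (insert c A) := by
    intro A
    rw [hX]
    refine ent_congr fun ω ω' => ?_
    rw [Prod.mk.injEq, joint_eq_iff, joint_eq_iff, Set.forall_mem_insert, and_comm]
  have key : ∀ N : ℕ, IsEntropic fun A => if A = ∅ then 0 else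
      (1 / ((N : ℝ) + 1)) * (h {c} + (N + 1 : ℕ) * (h (insert c A) - h {c})) +
        Real.binEntropy (1 / ((N : ℝ) + 1)) / Real.log 2 := by
    intro N
    obtain ⟨Ω', _, p', α', X', W', hp', hW, hX'⟩ := exists_conditional_copies hp X (X c) (N + 1)
    -- the copy of `X_c` is attached to every variable, so that it is part of every nonempty
    -- collection
    let X'' : ∀ i, Ω' → α' i × α c := fun i ω => (X' i ω, W' ω)
    have h1 : IsEntropic fun A => ent p' (joint X'' A) :=
      isEntropic_iff.2 ⟨Ω', inferInstance, p', hp', _, X'', fun A => rfl⟩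
    have h2 := h1.mask (t := 1 / ((N : ℝ) + 1)) (by positivity)
      (by rw [div_le_one (by positivity)]; linarith [Nat.cast_nonneg (α := ℝ) N])
    convert h2 using 1
    funext A
    split_ifs with hA'
    · rfl
    obtain ⟨a, ha⟩ := Set.nonempty_iff_ne_empty.2 hA'
    have h3 := hX' A
    rw [hc, hA] at h3
    rw [← h3]
    congr 2
    refine ent_congr fun ω ω' => ?_
    simp only [joint_eq_iff, Prod.mk.injEq, X'']
    exact ⟨fun h i hi => ⟨h.1 i hi, h.2⟩, fun h => ⟨fun i hi => (h i hi).1, (h a ha).2⟩⟩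
  refine mem_closure_of_tendsto (b := atTop) (tendsto_pi_nhds.2 fun A => ?_)
    (Eventually.of_forall key)
  by_cases hA' : A = ∅
  · subst hA'
    simp
  simp only [hA', if_false]
  have ht : Tendsto (fun N : ℕ => 1 / ((N : ℝ) + 1)) atTop (𝓝 0) :=
    tendsto_one_div_add_atTop_nhds_zero_nat
  have hb : Tendsto (fun N : ℕ => Real.binEntropy (1 / ((N : ℝ) + 1))) atTop (𝓝 0) := by
    have := (Real.binEntropy_continuous.tendsto 0).comp ht
    simpa [Function.comp_def] using this
  have e : (fun N : ℕ => (1 / ((N : ℝ) + 1)) * (h {c} + (N + 1 : ℕ) * (h (insert c A) - h {c})) +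
        Real.binEntropy (1 / ((N : ℝ) + 1)) / Real.log 2) = fun N : ℕ =>
      (1 / ((N : ℝ) + 1)) * h {c} + (h (insert c A) - h {c}) +
        Real.binEntropy (1 / ((N : ℝ) + 1)) / Real.log 2 := by
    funext N
    have : (N : ℝ) + 1 ≠ 0 := by positivity
    push_cast
    field_simp
  rw [e]
  have := ((ht.mul_const (h {c})).add_const (h (insert c A) - h {c})).add
    (hb.div_const (Real.log 2))
  simpa using this

/-! ### Limits of entropic polymatroids -/

/-- The limits of entropic polymatroids, for pointwise convergence of nets. -/
def entClosure (E : Type*) : Set (Set E → ℝ) := closure {h | IsEntropic h}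

section
variable {E E' : Type*} {f : Set E → ℝ}

theorem IsPolymatroid.nonneg (hf : IsPolymatroid f) (A : Set E) : 0 ≤ f A :=
  hf.empty ▸ hf.mono ∅ A (Set.empty_subset A)

theorem IsPolymatroid.union_le (hf : IsPolymatroid f) (A B : Set E) : f (A ∪ B) ≤ f A + f B := by
  linarith [hf.submodular A B, hf.nonneg (A ∩ B)]

theorem isClosed_setOf_isPolymatroid : IsClosed {f : Set E → ℝ | IsPolymatroid f} := by
  have : {f : Set E → ℝ | IsPolymatroid f} = {f | f ∅ = 0} ∩
      (⋂ (A) (B) (_ : A ⊆ B), {f | f A ≤ f B}) ∩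
      ⋂ (A) (B), {f | f (A ∪ B) + f (A ∩ B) ≤ f A + f B} := by
    ext f
    simp only [Set.mem_inter_iff, Set.mem_ofPred_eq, Set.mem_iInter]
    exact ⟨fun h => ⟨⟨h.empty, h.mono⟩, h.submodular⟩, fun h => ⟨h.1.1, h.1.2, h.2⟩⟩
  rw [this]
  refine ((isClosed_eq (by fun_prop) (by fun_prop)).inter ?_).inter ?_
  · exact isClosed_iInter fun A => isClosed_iInter fun B => isClosed_iInter fun _ =>
      isClosed_le (by fun_prop) (by fun_prop)
  · exact isClosed_iInter fun A => isClosed_iInter fun B =>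
      isClosed_le (by fun_prop) (by fun_prop)

theorem isPolymatroid_of_mem_entClosure (hf : f ∈ entClosure E) : IsPolymatroid f :=
  closure_minimal (fun _ hh => IsEntropic.isPolymatroid hh) isClosed_setOf_isPolymatroid hf

theorem IsAlmostEntropic.mem_entClosure (hf : IsAlmostEntropic f) : f ∈ entClosure E := by
  obtain ⟨h, hh, hlim⟩ := hf.exists_limit
  exact mem_closure_of_tendsto (tendsto_pi_nhds.2 hlim) (Eventually.of_forall fun n => (hh n).2)

theorem IsEntropic.comap {h : Set E → ℝ} (hh : IsEntropic h) (φ : E' → E) :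
    IsEntropic fun A => h (φ '' A) := by
  obtain ⟨Ω, _, p, hp, α, X, hX⟩ := isEntropic_iff.1 hh
  refine isEntropic_iff.2 ⟨Ω, inferInstance, p, hp, _, fun i => X (φ i), fun A => ?_⟩
  rw [hX]
  refine ent_congr fun ω ω' => ?_
  rw [joint_eq_iff, joint_eq_iff, Set.forall_mem_image]

theorem comap_mem_entClosure (hf : f ∈ entClosure E) (φ : E' → E) :
    (fun A => f (φ '' A)) ∈ entClosure E' :=
  map_mem_closure (f := fun (f : Set E → ℝ) A => f (φ '' A)) (by fun_prop) hf
    fun _ hh => IsEntropic.comap hh φ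

theorem contract_mem_entClosure (hf : f ∈ entClosure E) (c : E) :
    (fun A => f (insert c A) - f {c}) ∈ entClosure E := by
  have := map_mem_closure (f := fun (f : Set E → ℝ) A => f (insert c A) - f {c})
    (t := entClosure E) (by fun_prop) hf fun _ hh => IsEntropic.contract_mem_closure hh c
  rwa [entClosure, closure_closure] at this

/-- Copies exist for limits of entropic polymatroids as well: the ranks of the copies of the
approximating polymatroids are bounded, so that these copies have a limit point. -/
theorem exists_isCopy (hf : f ∈ entClosure E) (Z : Set E) :
    ∃ g ∈ entClosure (E ⊕ E), IsCopy f Z g := by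
  classical
  obtain ⟨l, hl, hlf⟩ := mem_closure_iff_ultrafilter.1 hf
  have hex : ∀ h : Set E → ℝ, ∃ g, IsEntropic h → IsEntropic g ∧ IsCopy h Z g := by
    intro h
    by_cases hh : IsEntropic h
    · obtain ⟨g, hg⟩ := hh.exists_isCopy Z
      exact ⟨g, fun _ => hg⟩
    · exact ⟨0, fun h' => absurd h' hh⟩
  choose G hG using hex
  have hent : ∀ᶠ h in (l : Filter (Set E → ℝ)), IsEntropic h := hl
  have hev : ∀ A, Tendsto (fun h : Set E → ℝ => h A) l (𝓝 (f A)) := fun A =>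
    ((continuous_apply A).tendsto f).mono_left hlf
  have hbd : ∀ᶠ h in (l : Filter (Set E → ℝ)), h Set.univ < f Set.univ + 1 :=
    (hev Set.univ).eventually (gt_mem_nhds (lt_add_one _))
  let K : Set (Set (E ⊕ E) → ℝ) := Set.pi Set.univ fun _ => Set.Icc 0 (2 * (f Set.univ + 1))
  have hK : IsCompact K := isCompact_univ_pi fun _ => isCompact_Icc
  have hKl : K ∈ l.map G := by
    change ∀ᶠ h in (l : Filter (Set E → ℝ)), G h ∈ K
    filter_upwards [hent, hbd] with h h1 h2
    obtain ⟨hg, hc⟩ := hG h h1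
    have hp := hg.isPolymatroid
    intro A _
    refine ⟨hp.nonneg A, ?_⟩
    have h3 := hp.mono A (Sum.inl '' Set.univ ∪ Sum.inr '' Set.univ) (by
      rintro (x | x) _
      · exact .inl ⟨x, trivial, rfl⟩
      · exact .inr ⟨x, trivial, rfl⟩)
    have h4 := hp.union_le (Sum.inl '' Set.univ) (Sum.inr '' Set.univ)
    rw [hc.left, hc.right] at h4
    linarith
  obtain ⟨g, -, hg⟩ := hK.ultrafilter_le_nhds' _ hKl
  have hgev : ∀ A, Tendsto (fun h : Set E → ℝ => G h A) l (𝓝 (g A)) := fun A =>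
    ((continuous_apply A).tendsto g).comp
      (Filter.tendsto_map'_iff.1 (Filter.tendsto_id.mono_left hg))
  refine ⟨g, mem_closure_iff_ultrafilter.2 ⟨l.map G, ?_, hg⟩, ?_, ?_, ?_, ?_⟩
  · change ∀ᶠ h in (l : Filter (Set E → ℝ)), IsEntropic (G h)
    filter_upwards [hent] with h h1 using (hG h h1).1
  · intro A
    refine tendsto_nhds_unique ((hgev _).congr' ?_) (hev A)
    filter_upwards [hent] with h h1 using (hG h h1).2.left A
  · intro A
    refine tendsto_nhds_unique ((hgev _).congr' ?_) (hev A)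
    filter_upwards [hent] with h h1 using (hG h h1).2.right A
  · intro A
    refine tendsto_nhds_unique ((hgev _).congr' ?_) (hev A)
    filter_upwards [hent] with h h1 using (hG h h1).2.glued A
  · intro A B hA hB
    refine tendsto_nhds_unique ((hgev _).congr' ?_) (((hev A).add (hev B)).sub (hev Z))
    filter_upwards [hent] with h h1 using (hG h h1).2.modular A B hA hB

/-! ### Polymatroids of finite type -/

/-- The polymatroid of finite type that agrees with `f` on finite sets. -/
noncomputable def finitary (f : Set E → ℝ) (A : Set E) : ℝ :=
  sSup {x : ℝ | ∃ F : Set E, F.Finite ∧ F ⊆ A ∧ f F = x}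

theorem IsPolymatroid.isLUB_finitary (hf : IsPolymatroid f) (A : Set E) :
    IsLUB {x : ℝ | ∃ F : Set E, F.Finite ∧ F ⊆ A ∧ f F = x} (finitary f A) := by
  refine isLUB_csSup ⟨f ∅, ∅, Set.finite_empty, Set.empty_subset _, rfl⟩ ⟨f A, ?_⟩
  rintro _ ⟨F, -, hF, rfl⟩
  exact hf.mono _ _ hF

theorem IsPolymatroid.finitary_of_finite (hf : IsPolymatroid f) {A : Set E} (hA : A.Finite) :
    finitary f A = f A := by
  refine (hf.isLUB_finitary A).unique ⟨?_, fun x hx => hx ⟨A, hA, subset_rfl, rfl⟩⟩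
  rintro _ ⟨F, -, hF, rfl⟩
  exact hf.mono _ _ hF

theorem IsPolymatroid.le_finitary (hf : IsPolymatroid f) {F A : Set E} (hF : F.Finite)
    (h : F ⊆ A) : f F ≤ finitary f A :=
  (hf.isLUB_finitary A).1 ⟨F, hF, h, rfl⟩

theorem IsPolymatroid.finitary_le (hf : IsPolymatroid f) {A : Set E} {x : ℝ}
    (h : ∀ F : Set E, F.Finite → F ⊆ A → f F ≤ x) : finitary f A ≤ x :=
  (hf.isLUB_finitary A).2 (by rintro _ ⟨F, h1, h2, rfl⟩; exact h F h1 h2)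

theorem IsPolymatroid.isFiniteType_finitary (hf : IsPolymatroid f) : IsFiniteType (finitary f) := by
  intro A
  convert hf.isLUB_finitary A using 1
  ext x
  refine exists_congr fun F => ⟨?_, ?_⟩
  · rintro ⟨h1, h2, h3⟩
    exact ⟨h1, h2, hf.finitary_of_finite h1 ▸ h3⟩
  · rintro ⟨h1, h2, h3⟩
    exact ⟨h1, h2, (hf.finitary_of_finite h1).trans h3⟩

theorem IsPolymatroid.isPolymatroid_finitary (hf : IsPolymatroid f) :
    IsPolymatroid (finitary f) := by
  refine ⟨?_, fun A B hAB => ?_, fun A B => ?_⟩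
  · rw [hf.finitary_of_finite Set.finite_empty, hf.empty]
  · exact hf.finitary_le fun F hF h => hf.le_finitary hF (h.trans hAB)
  · rw [← le_sub_iff_add_le]
    refine hf.finitary_le fun F hF hFA => ?_
    rw [le_sub_comm]
    refine hf.finitary_le fun F' hF' hFA' => ?_
    have hA := hf.le_finitary (F := F ∩ A ∪ F') (A := A) ((hF.inter_of_left A).union hF')
      (Set.union_subset Set.inter_subset_right (hFA'.trans Set.inter_subset_left))
    have hB := hf.le_finitary (F := F ∩ B ∪ F') (A := B) ((hF.inter_of_left B).union hF')
      (Set.union_subset Set.inter_subset_right (hFA'.trans Set.inter_subset_right))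
    have h1 := hf.submodular (F ∩ A ∪ F') (F ∩ B ∪ F')
    have h2 := hf.mono F ((F ∩ A ∪ F') ∪ (F ∩ B ∪ F')) (fun x hx => by
      rcases hFA hx with h | h
      · exact .inl (.inl ⟨hx, h⟩)
      · exact .inr (.inl ⟨hx, h⟩))
    have h3 := hf.mono F' ((F ∩ A ∪ F') ∩ (F ∩ B ∪ F')) (fun x hx => ⟨.inr hx, .inr hx⟩)
    linarith

/-- On a countable ground set, a polymatroid that is approximated by entropic ones on all finite
collections of sets has a finitary modification that is almost entropic: the variables outside an
increasing sequence of finite sets are replaced by constants. -/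
theorem isAlmostEntropic_finitary [Countable E] (hf : f ∈ entClosure E) :
    IsAlmostEntropic (finitary f) := by
  classical
  have hp := isPolymatroid_of_mem_entClosure hf
  refine ⟨hp.isPolymatroid_finitary, hp.isFiniteType_finitary, ?_⟩
  obtain ⟨enc, henc⟩ := Countable.exists_injective_nat E
  let D : ℕ → Set E := fun n => {x | enc x < n}
  have hD : ∀ n, (D n).Finite := fun n =>
    Set.Finite.preimage henc.injOn (Set.finite_lt_nat n)
  have hDmono : Monotone D := fun m n hmn x hx => lt_of_lt_of_le hx hmn
  have happrox : ∀ n : ℕ, ∃ h : Set E → ℝ, IsEntropic h ∧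
      ∀ A ⊆ D n, |h A - f A| < 1 / ((n : ℝ) + 1) := by
    intro n
    have hfin : (𝒫 (D n)).Finite := (hD n).powerset
    have hU : {h : Set E → ℝ | ∀ A ∈ 𝒫 (D n), |h A - f A| < 1 / ((n : ℝ) + 1)} ∈ 𝓝 f := by
      refine (Filter.eventually_all_finite hfin).2 fun A _ => ?_
      have := (continuous_apply A).tendsto f
      filter_upwards [this.eventually (Metric.ball_mem_nhds _ (Nat.one_div_pos_of_nat (n := n)))]
        with h hh
      exact hh
    obtain ⟨h, h1, h2⟩ := mem_closure_iff_nhds.1 hf _ hU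
    exact ⟨h, h2, fun A hA => h1 A hA⟩
  choose h hent hh using happrox
  have htrunc : ∀ n, IsEntropic fun A => h n (A ∩ D n) := by
    intro n
    obtain ⟨Ω, _, p, hp, α, X, hX⟩ := isEntropic_iff.1 (hent n)
    refine isEntropic_iff.2 ⟨Ω, inferInstance, p, hp, fun i => Option (α i),
      fun i ω => if i ∈ D n then some (X i ω) else none, fun A => ?_⟩
    rw [hX]
    refine ent_congr fun ω ω' => ?_
    rw [joint_eq_iff, joint_eq_iff]
    constructor
    · intro h i hi
      by_cases hiD : i ∈ D n
      · simp [hiD, h i ⟨hi, hiD⟩]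
      · simp [hiD]
    · intro h i hi
      simpa [hi.2] using h i hi.1
  refine ⟨fun n A => h n (A ∩ D n), fun n => ⟨(htrunc n).isPolymatroid, htrunc n⟩, fun A => ?_⟩
  have h1 : Tendsto (fun n => f (A ∩ D n)) atTop (𝓝 (finitary f A)) := by
    have hmono : Monotone fun n => f (A ∩ D n) := fun m n hmn =>
      hp.mono _ _ (Set.inter_subset_inter_right A (hDmono hmn))
    refine tendsto_atTop_isLUB hmono ⟨?_, fun x hx => ?_⟩
    · rintro _ ⟨n, rfl⟩
      exact hp.le_finitary ((hD n).inter_of_right A) Set.inter_subset_left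
    · refine hp.finitary_le fun F hF hFA => ?_
      obtain ⟨n, hn⟩ : ∃ n, F ⊆ D n := by
        obtain ⟨n, hn⟩ := (hF.image enc).bddAbove
        exact ⟨n + 1, fun x hx => Nat.lt_succ_of_le (hn ⟨x, hx, rfl⟩)⟩
      exact (hp.mono _ _ (Set.subset_inter hFA hn)).trans (hx ⟨n, rfl⟩)
  have h2 : Tendsto (fun n => h n (A ∩ D n) - f (A ∩ D n)) atTop (𝓝 0) := by
    refine squeeze_zero_norm (fun n => ?_) tendsto_one_div_add_atTop_nhds_zero_nat
    exact (hh n _ Set.inter_subset_right).le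
  simpa using h2.add h1

end

/-! ### Closure in polymatroids -/

section
variable {E E' : Type*} {f : Set E → ℝ}

theorem IsPolymatroid.mem_polyClosure_iff (hf : IsPolymatroid f) {A : Set E} {x : E} :
    x ∈ polyClosure f A ↔ f (A ∪ {x}) ≤ f A :=
  ⟨fun h => (Eq.symm h).le, fun h => le_antisymm (hf.mono _ _ Set.subset_union_left) h⟩

theorem subset_polyClosure (A : Set E) : A ⊆ polyClosure f A := by
  intro x hx
  change f A = f (A ∪ {x})
  rw [Set.union_eq_self_of_subset_right (Set.singleton_subset_iff.2 hx)]

theorem IsPolymatroid.polyClosure_mono (hf : IsPolymatroid f) {A B : Set E} (h : A ⊆ B) :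
    polyClosure f A ⊆ polyClosure f B := by
  intro x hx
  rw [hf.mem_polyClosure_iff] at hx ⊢
  have h1 := hf.submodular (A ∪ {x}) B
  have h2 := hf.mono A ((A ∪ {x}) ∩ B) (Set.subset_inter Set.subset_union_left h)
  have h3 := hf.mono (B ∪ {x}) (A ∪ {x} ∪ B) (by
    rintro y (hy | hy)
    exacts [.inr hy, .inl (.inr hy)])
  linarith

theorem IsPolymatroid.union_le_of_subset_polyClosure (hf : IsPolymatroid f) {A T : Set E}
    (hT : T.Finite) (h : T ⊆ polyClosure f A) : f (A ∪ T) ≤ f A := by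
  induction T, hT using Set.Finite.induction_on with
  | empty => simp
  | @insert x T _ _ ih =>
    have h1 := hf.polyClosure_mono (Set.subset_union_left (t := T)) (h (Set.mem_insert x T))
    rw [hf.mem_polyClosure_iff] at h1
    have e : A ∪ insert x T = A ∪ T ∪ {x} := by
      rw [Set.union_assoc, Set.union_singleton]
    rw [e]
    exact h1.trans (ih ((Set.subset_insert x T).trans h))

theorem IsPolymatroid.le_of_subset_polyClosure (hf : IsPolymatroid f) {A T : Set E}
    (hT : T.Finite) (h : T ⊆ polyClosure f A) : f T ≤ f A :=
  (hf.mono _ _ Set.subset_union_right).trans (hf.union_le_of_subset_polyClosure hT h)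

theorem IsPolymatroid.mem_polyClosure_trans (hf : IsPolymatroid f) {A B : Set E} {x : E}
    (hA : A.Finite) (hx : x ∈ polyClosure f A) (h : A ⊆ polyClosure f B) :
    x ∈ polyClosure f B := by
  have h1 := hf.polyClosure_mono (Set.subset_union_right (s := B)) hx
  rw [hf.mem_polyClosure_iff] at h1 ⊢
  have h2 := hf.union_le_of_subset_polyClosure hA h
  have h3 := hf.mono (B ∪ {x}) (B ∪ A ∪ {x}) (Set.union_subset_union_left _ Set.subset_union_left)
  linarith

/-- For infinite sets the rank of a closure is controlled only for polymatroids of finite type. -/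
theorem IsPolymatroid.le_of_subset_polyClosure_of_isFiniteType (hf : IsPolymatroid f)
    (hft : IsFiniteType f) {A T : Set E} (h : T ⊆ polyClosure f A) : f T ≤ f A := by
  refine (hft T).2 ?_
  rintro _ ⟨F, hF, hFT, rfl⟩
  exact hf.le_of_subset_polyClosure hF (hFT.trans h)

theorem mem_polyClosure_image {g : Set E' → ℝ} {φ : E → E'} (h : ∀ A, g (φ '' A) = f A) {A : Set E}
    {x : E} (hx : x ∈ polyClosure f A) : φ x ∈ polyClosure g (φ '' A) := by
  change g (φ '' A) = g (φ '' A ∪ {φ x})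
  rw [← Set.image_singleton, ← Set.image_union, h, h]
  exact hx

theorem IsPolymatroid.insert_le (hf : IsPolymatroid f) (x : E) (A : Set E) :
    f (insert x A) ≤ f {x} + f A := by
  rw [Set.insert_eq]; exact hf.union_le _ _

/-- Two points `x`, `y` that, together with `a`, span a set of rank three have rank two. -/
theorem IsPolymatroid.two_le_pair (hf : IsPolymatroid f) {a b c x y : E} (h3 : 3 ≤ f {a, b, c})
    (ha : f {a} ≤ 1) (hb : b ∈ polyClosure f {a, x}) (hc : c ∈ polyClosure f {a, y}) :
    2 ≤ f {x, y} := by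
  have h1 : f {a, b, c} ≤ f {a, x, y} := by
    refine hf.le_of_subset_polyClosure (Set.toFinite _) ?_
    rintro z (rfl | rfl | rfl)
    · exact subset_polyClosure _ (by simp)
    · exact hf.polyClosure_mono (by rintro w (rfl | rfl) <;> simp) hb
    · exact hf.polyClosure_mono (by rintro w (rfl | rfl) <;> simp) hc
  have := hf.insert_le a {x, y}
  linarith

end

/-! ### Partial Dowling geometries -/

theorem labelled_symm {r : ℕ} {S E : Type*} (σ : GenStructure S) (pt : IndexPair r → S → E)
    {i j : Fin r} (hij : i ≠ j) (hji : j ≠ i) (s : S) :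
    labelled σ pt j i hji (σ.inv s) = labelled σ pt i j hij s := by
  unfold labelled
  rcases lt_or_gt_of_ne hij with h | h
  · rw [dif_neg h.not_gt, dif_pos h, σ.inv_inv]
  · rw [dif_pos h, dif_neg h.not_gt]

section
variable {r : ℕ} {S E : Type*} {σ : GenStructure S} (G : PDG r σ E)

/-- The element `s_{i,j}` of a partial Dowling geometry. -/
def PDG.lab (i j : Fin r) (hij : i ≠ j) (s : S) : E := labelled σ G.pt i j hij s

theorem PDG.lab_symm {i j : Fin r} (hij : i ≠ j) (s : S) :
    G.lab j i hij.symm (σ.inv s) = G.lab i j hij s := labelled_symm σ G.pt hij hij.symm s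

theorem PDG.b_injective : Function.Injective G.b := fun i j h => by
  have := G.partition.1 (a₁ := Sum.inl i) (a₂ := Sum.inl j) h
  simpa using this

theorem PDG.rank_b_image (T : Set (Fin r)) : G.rank (G.b '' T) = T.ncard := by
  rw [G.basis _ (Set.image_subset_range _ _), Set.ncard_image_of_injective _ G.b_injective]

theorem PDG.rank_b (i : Fin r) : G.rank {G.b i} = 1 := by
  have := G.rank_b_image {i}
  simpa using this

theorem PDG.rank_b_pair {i j : Fin r} (hij : i ≠ j) : G.rank {G.b i, G.b j} = 2 := by
  have := G.rank_b_image {i, j}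
  rwa [Set.image_pair, Set.ncard_pair hij] at this

theorem PDG.rank_b_triple {i j k : Fin r} (hij : i ≠ j) (hjk : j ≠ k) (hki : k ≠ i) :
    G.rank {G.b i, G.b j, G.b k} = 3 := by
  have := G.rank_b_image {i, j, k}
  rwa [Set.image_insert_eq, Set.image_pair, Set.ncard_eq_three.2 ⟨i, j, k, hij, hki.symm, hjk, rfl⟩]
    at this

theorem PDG.b_mem_polyClosure {i j : Fin r} (hij : i ≠ j) (s : S) :
    G.b j ∈ polyClosure G.rank {G.b i, G.lab i j hij s} := by
  rw [G.isPolymatroid.mem_polyClosure_iff]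
  have h1 := (G.nondegenerate i j hij s).2
  have h2 := G.frame i j hij s
  rw [G.isPolymatroid.mem_polyClosure_iff, G.rank_b_pair hij] at h2
  have h3 : ({G.b i, G.lab i j hij s} ∪ {G.b j} : Set E) = {G.b i, G.b j} ∪ {G.lab i j hij s} := by
    ext; simp; tauto
  rw [h3]
  change _ ≤ G.rank {G.b i, labelled σ G.pt i j hij s}
  rw [h1]
  exact h2

theorem PDG.two_le_rank_lab_pair {i j k : Fin r} (hij : i ≠ j) (hjk : j ≠ k) (hki : k ≠ i)
    (s t : S) : 2 ≤ G.rank {G.lab i j hij s, G.lab i k hki.symm t} :=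
  G.isPolymatroid.two_le_pair (G.rank_b_triple hij hjk hki).ge (G.rank_b i).le
    (G.b_mem_polyClosure hij s) (G.b_mem_polyClosure hki.symm t)

theorem PDG.rank_coherent {i j k : Fin r} (hij : i ≠ j) (hkj : k ≠ j) (hki : k ≠ i) (s : S) :
    G.rank {G.lab i j hij s, G.lab k j hkj s, G.lab k i hki σ.e} = 2 := by
  rw [← G.lab_symm hkj s]
  exact G.coherent i j k hij hkj.symm hki s

/-- Each of three coherent elements is spanned by the other two. -/
theorem PDG.lab_mem_polyClosure {i j k : Fin r} (hij : i ≠ j) (hkj : k ≠ j) (hki : k ≠ i) (s : S) :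
    G.lab i j hij s ∈ polyClosure G.rank {G.lab k j hkj s, G.lab k i hki σ.e} := by
  rw [G.isPolymatroid.mem_polyClosure_iff, Set.union_singleton, G.rank_coherent]
  exact G.two_le_rank_lab_pair hkj hij.symm hki.symm _ _

theorem PDG.lab_e_mem_polyClosure {i j k : Fin r} (hij : i ≠ j) (hkj : k ≠ j) (hki : k ≠ i)
    (s : S) :
    G.lab k i hki σ.e ∈ polyClosure G.rank {G.lab i j hij s, G.lab k j hkj s} := by
  rw [G.isPolymatroid.mem_polyClosure_iff]
  have : ({G.lab i j hij s, G.lab k j hkj s} ∪ {G.lab k i hki σ.e} : Set E) =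
      {G.lab i j hij s, G.lab k j hkj s, G.lab k i hki σ.e} := by
    ext; simp; tauto
  rw [this, G.rank_coherent, ← G.lab_symm hij, ← G.lab_symm hkj]
  exact G.two_le_rank_lab_pair hij.symm hki.symm hkj _ _

/-- The line through `b_i` and `b_j`. -/
def PDG.line (i j : Fin r) (hij : i ≠ j) : Set E :=
  {G.b i, G.b j} ∪ Set.range (G.lab i j hij)

theorem PDG.line_symm {i j : Fin r} (hij : i ≠ j) : G.line j i hij.symm = G.line i j hij := by
  unfold PDG.line
  rw [Set.pair_comm]
  congr 1
  ext x
  constructor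
  · rintro ⟨s, rfl⟩
    exact ⟨σ.inv s, G.lab_symm hij.symm s⟩
  · rintro ⟨s, rfl⟩
    exact ⟨σ.inv s, G.lab_symm hij s⟩

theorem PDG.line_subset {i j : Fin r} (hij : i ≠ j) :
    G.line i j hij ⊆ polyClosure G.rank {G.b i, G.b j} := by
  rintro x (hx | ⟨s, rfl⟩)
  · exact subset_polyClosure _ hx
  · exact G.frame i j hij s

theorem PDG.rank_line_le (hft : IsFiniteType G.rank) {i j : Fin r} (hij : i ≠ j) :
    G.rank (G.line i j hij) ≤ 2 :=
  (G.isPolymatroid.le_of_subset_polyClosure_of_isFiniteType hft (G.line_subset hij)).trans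
    (G.rank_b_pair hij).le

theorem PDG.rank_univ_le (hft : IsFiniteType G.rank) : G.rank Set.univ ≤ r := by
  have h : Set.univ ⊆ polyClosure G.rank (Set.range G.b) := by
    intro x _
    obtain ⟨y, rfl⟩ := G.partition.2 x
    rcases y with i | ⟨⟨⟨i, j⟩, hij⟩, s⟩
    · exact subset_polyClosure _ ⟨i, rfl⟩
    · refine G.isPolymatroid.polyClosure_mono ?_ (G.line_subset (Fin.ne_of_lt hij) (.inr ⟨s, ?_⟩))
      · rintro x (rfl | rfl) <;> exact Set.mem_range_self _
      · simp only [PDG.lab, labelled, Sum.elim_inr]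
        exact dif_pos hij
  refine (G.isPolymatroid.le_of_subset_polyClosure_of_isFiniteType hft h).trans ?_
  rw [← Set.image_univ, G.rank_b_image]
  simp [Set.ncard_univ]

end

/-! ### An amalgam of four copies of a geometry of rank three -/

/-- The polymatroid `g` is generated by copies `κ t` of the geometry `G`, one for each choice `t` of
one of two points over each `b_i`. Copies given by choices that agree at `i` share `b_i`, those
given by choices that agree at `i` and `j` share the line through `b_i` and `b_j`. There is one
point over `b_0`, and two independent ones over `b_1` and over `b_2`. -/
structure IsAmalgam {S E F : Type*} {σ : GenStructure S} (G : PDG 3 σ E) (g : Set F → ℝ)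
    (κ : (Fin 3 → Bool) → E → F) : Prop where
  isPolymatroid : IsPolymatroid g
  rank_image : ∀ t A, g (κ t '' A) = G.rank A
  map_b : ∀ {t t' : Fin 3 → Bool} {i : Fin 3}, t i = t' i → κ t (G.b i) = κ t' (G.b i)
  map_lab : ∀ {t t' : Fin 3 → Bool} {i j : Fin 3} (hij : i ≠ j) (s : S), t i = t' i → t j = t' j →
    κ t (G.lab i j hij s) = κ t' (G.lab i j hij s)
  five_le : 5 ≤ g {κ (fun _ => false) (G.b 0), κ (fun _ => false) (G.b 1),
    κ (fun _ => true) (G.b 1), κ (fun _ => false) (G.b 2), κ (fun _ => true) (G.b 2)}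

/-- The amalgam is obtained by gluing two copies of `G` along a line through `b_0`, and then two
copies of the result along the plane spanned by the other lines through `b_0`. -/
theorem exists_isAmalgam {S : Type u} {E : Type v} {σ : GenStructure S} (G : PDG 3 σ E)
    (hG : IsAlmostEntropic G.rank) :
    ∃ (F : Type v) (g : Set F → ℝ) (κ : (Fin 3 → Bool) → E → F), g ∈ entClosure F ∧
      IsAmalgam G g κ := by
  have hft := hG.isFiniteType
  have h01 : (0 : Fin 3) ≠ 1 := by decide
  have h02 : (0 : Fin 3) ≠ 2 := by decide
  let Z₁ : Set E := G.line 0 1 h01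
  obtain ⟨g₁, hg₁, hc₁⟩ := exists_isCopy hG.mem_entClosure Z₁
  have hp₁ := isPolymatroid_of_mem_entClosure hg₁
  let Z₂ : Set (E ⊕ E) := Sum.inl '' G.line 0 2 h02 ∪ glue Z₁ '' G.line 0 2 h02
  obtain ⟨g₂, hg₂, hc₂⟩ := exists_isCopy hg₁ Z₂
  have hp₂ := isPolymatroid_of_mem_entClosure hg₂
  let ι₁ : Bool → E → E ⊕ E := fun y => bif y then glue Z₁ else Sum.inl
  let ι₂ : Bool → E ⊕ E → (E ⊕ E) ⊕ (E ⊕ E) := fun x => bif x then glue Z₂ else Sum.inl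
  have hι₁ : ∀ y A, g₁ (ι₁ y '' A) = G.rank A := by
    intro y A; cases y
    exacts [hc₁.left A, hc₁.glued A]
  have hι₂ : ∀ x A, g₂ (ι₂ x '' A) = g₁ A := by
    intro x A; cases x
    exacts [hc₂.left A, hc₂.glued A]
  have hline₁ : ∀ y, ∀ x ∈ Z₁, ι₁ y x = Sum.inl x := by
    intro y x hx; cases y
    exacts [rfl, glue_of_mem hx]
  have hline₂ : ∀ y y', ∀ x ∈ G.line 0 2 h02, ι₂ y (ι₁ y' x) = Sum.inl (ι₁ y' x) := by
    intro y y' x hx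
    have : ι₁ y' x ∈ Z₂ := by
      cases y'
      exacts [.inl ⟨x, hx, rfl⟩, .inr ⟨x, hx, rfl⟩]
    cases y
    exacts [rfl, glue_of_mem this]
  let κ : (Fin 3 → Bool) → E → (E ⊕ E) ⊕ (E ⊕ E) := fun t x => ι₂ (t 1) (ι₁ (t 2) x)
  have hκ : ∀ t A, g₂ (κ t '' A) = G.rank A := by
    intro t A
    have : κ t '' A = ι₂ (t 1) '' (ι₁ (t 2) '' A) := (Set.image_image _ _ _).symm
    rw [this, hι₂, hι₁]
  have hκ01 : ∀ {t t' : Fin 3 → Bool}, ∀ x ∈ G.line 0 1 h01, t 1 = t' 1 → κ t x = κ t' x := by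
    intro t t' x hx h
    simp only [κ, hline₁ _ x hx, h]
  have hκ02 : ∀ {t t' : Fin 3 → Bool}, ∀ x ∈ G.line 0 2 h02, t 2 = t' 2 → κ t x = κ t' x := by
    intro t t' x hx h
    simp only [κ, hline₂ _ _ x hx, h]
  have hκ12 : ∀ {t t' : Fin 3 → Bool} x, t 1 = t' 1 → t 2 = t' 2 → κ t x = κ t' x := by
    intro t t' x h h'
    simp only [κ, h, h']
  have hκ0 : ∀ t t' : Fin 3 → Bool, κ t (G.b 0) = κ t' (G.b 0) := by
    intro t t'
    have h1 := hκ01 (t := t) (t' := ![true, t 1, t' 2]) (G.b 0) (.inl (by simp)) rfl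
    have h2 := hκ02 (t := ![true, t 1, t' 2]) (t' := t') (G.b 0) (.inl (by simp)) rfl
    exact h1.trans h2
  have hκb : ∀ {t t' : Fin 3 → Bool} {i : Fin 3}, t i = t' i → κ t (G.b i) = κ t' (G.b i) := by
    intro t t' i h
    match i with
    | 0 => exact hκ0 t t'
    | 1 => exact hκ01 _ (.inl (by simp)) h
    | 2 => exact hκ02 _ (.inl (by simp)) h
  refine ⟨_, g₂, κ, hg₂, hp₂, hκ, hκb, ?_, ?_⟩
  · intro t t' i j hij s hi hj
    have hmem : G.lab i j hij s ∈ G.line i j hij := .inr ⟨s, rfl⟩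
    match i, j with
    | 0, 0 => exact absurd rfl hij
    | 1, 1 => exact absurd rfl hij
    | 2, 2 => exact absurd rfl hij
    | 0, 1 => exact hκ01 _ hmem hj
    | 1, 0 => exact hκ01 _ (G.line_symm h01 ▸ hmem) hi
    | 0, 2 => exact hκ02 _ hmem hj
    | 2, 0 => exact hκ02 _ (G.line_symm h02 ▸ hmem) hi
    | 1, 2 => exact hκ12 _ hi hj
    | 2, 1 => exact hκ12 _ hj hi
  · have hr3 : 3 ≤ G.rank Set.univ := by
      rw [← G.rank_b_triple (i := 0) (j := 1) (k := 2) (by decide) (by decide) (by decide)]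
      exact G.isPolymatroid.mono _ _ (Set.subset_univ _)
    have hZ₁ := G.rank_line_le hft h01
    let U : Set (E ⊕ E) := Sum.inl '' Set.univ ∪ glue Z₁ '' Set.univ
    have hU : 4 ≤ g₁ U := by
      rw [hc₁.modular _ _ (Set.subset_univ _) (Set.subset_univ _)]
      linarith
    -- the two lines that generate the plane `Z₂` meet in `b_0`
    have hZ₂ : g₁ Z₂ ≤ 3 := by
      have h1 := hp₁.submodular (Sum.inl '' G.line 0 2 h02) (glue Z₁ '' G.line 0 2 h02)
      have h2 := hp₁.mono (Sum.inl '' {G.b 0})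
        (Sum.inl '' G.line 0 2 h02 ∩ glue Z₁ '' G.line 0 2 h02) (by
          rintro _ ⟨_, rfl, rfl⟩
          have hb : G.b 0 ∈ G.line 0 2 h02 := .inl (by simp)
          exact ⟨⟨_, hb, rfl⟩, _, hb, glue_of_mem (.inl (by simp))⟩)
      rw [hc₁.left, hc₁.glued] at h1
      rw [hc₁.left, G.rank_b] at h2
      have h3 := G.rank_line_le hft h02
      change g₁ (Sum.inl '' G.line 0 2 h02 ∪ glue Z₁ '' G.line 0 2 h02) ≤ 3
      linarith
    have hZU : Z₂ ⊆ U := Set.union_subset_union (Set.image_mono (Set.subset_univ _))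
      (Set.image_mono (Set.subset_univ _))
    have h5 : 5 ≤ g₂ (Sum.inl '' U ∪ glue Z₂ '' U) := by
      rw [hc₂.modular _ _ hZU hZU]
      linarith
    set T : Set ((E ⊕ E) ⊕ (E ⊕ E)) := {κ (fun _ => false) (G.b 0), κ (fun _ => false) (G.b 1),
      κ (fun _ => true) (G.b 1), κ (fun _ => false) (G.b 2), κ (fun _ => true) (G.b 2)} with hT
    have hbT : ∀ t i, κ t (G.b i) ∈ T := by
      intro t i
      match i with
      | 0 => simp [hT, hκ0 t fun _ => false]
      | 1 =>
        cases h : t 1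
        · simp [hT, hκb (t := t) (t' := fun _ => false) (i := 1) h]
        · simp [hT, hκb (t := t) (t' := fun _ => true) (i := 1) h]
      | 2 =>
        cases h : t 2
        · simp [hT, hκb (t := t) (t' := fun _ => false) (i := 2) h]
        · simp [hT, hκb (t := t) (t' := fun _ => true) (i := 2) h]
    -- the four copies of `G`, each spanned by points in `T`, are added to `T` one by one
    have hstep : ∀ t W, T ⊆ W → g₂ (W ∪ κ t '' Set.univ) ≤ g₂ W := by
      intro t W hW
      have h1 := hp₂.submodular W (κ t '' Set.univ)
      have h2 := hp₂.mono (κ t '' {G.b 0, G.b 1, G.b 2}) (W ∩ κ t '' Set.univ) (by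
        rintro _ ⟨x, hx, rfl⟩
        refine ⟨hW ?_, x, trivial, rfl⟩
        rcases hx with rfl | rfl | rfl <;> exact hbT _ _)
      rw [hκ, G.rank_b_triple (by decide) (by decide) (by decide)] at h2
      rw [hκ] at h1
      have h3 := G.rank_univ_le hft
      push_cast at h3
      linarith
    let c : Bool → Bool → Fin 3 → Bool := fun x y => ![false, x, y]
    have hsub : Sum.inl '' U ∪ glue Z₂ '' U ⊆ T ∪ κ (c false false) '' Set.univ ∪
        κ (c false true) '' Set.univ ∪ κ (c true false) '' Set.univ ∪
        κ (c true true) '' Set.univ := by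
      rintro _ (⟨_, (⟨x, -, rfl⟩ | ⟨x, -, rfl⟩), rfl⟩ | ⟨_, (⟨x, -, rfl⟩ | ⟨x, -, rfl⟩), rfl⟩)
      · exact .inl (.inl (.inl (.inr ⟨x, trivial, rfl⟩)))
      · exact .inl (.inl (.inr ⟨x, trivial, rfl⟩))
      · exact .inl (.inr ⟨x, trivial, rfl⟩)
      · exact .inr ⟨x, trivial, rfl⟩
    have hsub1 := hstep (c false false) T subset_rfl
    have hsub2 := hstep (c false true) _
      (Set.subset_union_left (s := T) (t := κ (c false false) '' Set.univ))
    have hsub3 := hstep (c true false) (T ∪ κ (c false false) '' Set.univ ∪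
        κ (c false true) '' Set.univ) fun x hx => .inl (.inl hx)
    have hsub4 := hstep (c true true) (T ∪ κ (c false false) '' Set.univ ∪
        κ (c false true) '' Set.univ ∪ κ (c true false) '' Set.univ)
        fun x hx => .inl (.inl (.inl hx))
    linarith [hp₂.mono _ _ hsub]

/-! ### Points and lines of the amalgam -/

section
variable {S E F : Type*} {σ : GenStructure S} {G : PDG 3 σ E} {g : Set F → ℝ}
  {κ : (Fin 3 → Bool) → E → F}

/-- The point of the amalgam that is the copy numbered `v.2` of `b_{v.1}`. -/
def vtx (G : PDG 3 σ E) (κ : (Fin 3 → Bool) → E → F) (v : Fin 3 × Bool) : F :=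
  κ (fun _ => v.2) (G.b v.1)

/-- The element of the amalgam that is labelled `s` on the line from `u` to `v`. Where `u` and `v`
lie over the same `b_i` there is no such element, and the value is irrelevant. -/
def edge (G : PDG 3 σ E) (κ : (Fin 3 → Bool) → E → F) (u v : Fin 3 × Bool) (s : S) : F :=
  if h : u.1 ≠ v.1 then κ (Function.update (fun _ => u.2) v.1 v.2) (G.lab u.1 v.1 h s)
  else κ (fun _ => false) (G.b 0)

variable (h : IsAmalgam G g κ)
include h

theorem IsAmalgam.vtx_eq {v : Fin 3 × Bool} {t : Fin 3 → Bool} (hv : t v.1 = v.2) :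
    vtx G κ v = κ t (G.b v.1) := h.map_b hv.symm

theorem IsAmalgam.edge_eq {u v : Fin 3 × Bool} (huv : u.1 ≠ v.1) {t : Fin 3 → Bool}
    (hu : t u.1 = u.2) (hv : t v.1 = v.2) (s : S) :
    edge G κ u v s = κ t (G.lab u.1 v.1 huv s) := by
  rw [edge, dif_pos huv]
  refine h.map_lab huv s ?_ ?_
  · rw [Function.update_of_ne huv, hu]
  · rw [Function.update_self, hv]

theorem IsAmalgam.edge_symm {u v : Fin 3 × Bool} (huv : u.1 ≠ v.1) (s : S) :
    edge G κ v u (σ.inv s) = edge G κ u v s := by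
  have hu : Function.update (fun _ => u.2) v.1 v.2 u.1 = u.2 := Function.update_of_ne huv _ _
  have hv : Function.update (fun _ => u.2) v.1 v.2 v.1 = v.2 := Function.update_self _ _ _
  rw [h.edge_eq huv hu hv, h.edge_eq huv.symm hv hu, G.lab_symm]

theorem IsAmalgam.edge_e_symm {u v : Fin 3 × Bool} (huv : u.1 ≠ v.1) :
    edge G κ v u σ.e = edge G κ u v σ.e := by
  rw [← h.edge_symm huv, σ.inv_e]

theorem IsAmalgam.rank_vtx (v : Fin 3 × Bool) : g {vtx G κ v} = 1 := by
  rw [vtx, ← Set.image_singleton, h.rank_image, G.rank_b]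

theorem IsAmalgam.rank_edge {u v : Fin 3 × Bool} (huv : u.1 ≠ v.1) (s : S) :
    g {edge G κ u v s} = 1 := by
  rw [edge, dif_pos huv, ← Set.image_singleton, h.rank_image]
  exact (G.nondegenerate _ _ huv s).1

theorem IsAmalgam.edge_mem_polyClosure {u v : Fin 3 × Bool} (huv : u.1 ≠ v.1) (s : S) :
    edge G κ u v s ∈ polyClosure g {vtx G κ u, vtx G κ v} := by
  have hu : Function.update (fun _ => u.2) v.1 v.2 u.1 = u.2 := Function.update_of_ne huv _ _
  have hv : Function.update (fun _ => u.2) v.1 v.2 v.1 = v.2 := Function.update_self _ _ _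
  rw [h.edge_eq huv hu hv, h.vtx_eq hu, h.vtx_eq hv, ← Set.image_pair]
  exact mem_polyClosure_image (h.rank_image _) (G.frame _ _ huv s)

theorem IsAmalgam.vtx_mem_polyClosure {u v : Fin 3 × Bool} (huv : u.1 ≠ v.1) (s : S) :
    vtx G κ v ∈ polyClosure g {vtx G κ u, edge G κ u v s} := by
  have hu : Function.update (fun _ => u.2) v.1 v.2 u.1 = u.2 := Function.update_of_ne huv _ _
  have hv : Function.update (fun _ => u.2) v.1 v.2 v.1 = v.2 := Function.update_self _ _ _
  rw [h.edge_eq huv hu hv, h.vtx_eq hu, h.vtx_eq hv, ← Set.image_pair]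
  exact mem_polyClosure_image (h.rank_image _) (G.b_mem_polyClosure huv s)

omit h in
theorem exists_choice {u v w : Fin 3 × Bool} (huv : u.1 ≠ v.1) (hwv : w.1 ≠ v.1)
    (hwu : w.1 ≠ u.1) : ∃ t : Fin 3 → Bool, t u.1 = u.2 ∧ t v.1 = v.2 ∧ t w.1 = w.2 := by
  refine ⟨Function.update (Function.update (fun _ => u.2) v.1 v.2) w.1 w.2, ?_, ?_, ?_⟩
  · rw [Function.update_of_ne hwu.symm, Function.update_of_ne huv]
  · rw [Function.update_of_ne hwv.symm, Function.update_self]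
  · rw [Function.update_self]

theorem IsAmalgam.edge_mem_polyClosure_edges {u v w : Fin 3 × Bool} (huv : u.1 ≠ v.1)
    (hwv : w.1 ≠ v.1) (hwu : w.1 ≠ u.1) (s : S) :
    edge G κ u v s ∈ polyClosure g {edge G κ w v s, edge G κ w u σ.e} := by
  obtain ⟨t, tu, tv, tw⟩ := exists_choice huv hwv hwu
  rw [h.edge_eq huv tu tv, h.edge_eq hwv tw tv, h.edge_eq hwu tw tu, ← Set.image_pair]
  exact mem_polyClosure_image (h.rank_image _) (G.lab_mem_polyClosure huv hwv hwu s)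

theorem IsAmalgam.edge_e_mem_polyClosure_edges {u v w : Fin 3 × Bool} (huv : u.1 ≠ v.1)
    (hwv : w.1 ≠ v.1) (hwu : w.1 ≠ u.1) (s : S) :
    edge G κ w u σ.e ∈ polyClosure g {edge G κ u v s, edge G κ w v s} := by
  obtain ⟨t, tu, tv, tw⟩ := exists_choice huv hwv hwu
  rw [h.edge_eq huv tu tv, h.edge_eq hwv tw tv, h.edge_eq hwu tw tu, ← Set.image_pair]
  exact mem_polyClosure_image (h.rank_image _) (G.lab_e_mem_polyClosure huv hwv hwu s)

end

/-! ### Contracting a point of the amalgam -/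

section
variable {F : Type*} {g : Set F → ℝ}

/-- The contraction of the element `c`. -/
def contraction (g : Set F → ℝ) (c : F) (A : Set F) : ℝ := g (insert c A) - g {c}

theorem IsPolymatroid.contract (hg : IsPolymatroid g) (c : F) :
    IsPolymatroid (contraction g c) := by
  refine ⟨?_, fun A B hAB => ?_, fun A B => ?_⟩ <;> unfold contraction
  · simp
  · linarith [hg.mono _ _ (Set.insert_subset_insert (a := c) hAB)]
  · have := hg.submodular (insert c A) (insert c B)
    rw [← Set.insert_union_distrib, ← Set.insert_inter_distrib] at this
    linarith

theorem IsPolymatroid.contract_le (hg : IsPolymatroid g) (c : F) (A : Set F) :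
    contraction g c A ≤ g A := by
  have := hg.insert_le c A
  unfold contraction; linarith

theorem IsPolymatroid.mem_polyClosure_contract (hg : IsPolymatroid g) {c x : F} {A B : Set F}
    (hx : x ∈ polyClosure g B) (hB : B ⊆ insert c A) : x ∈ polyClosure (contraction g c) A := by
  have := hg.polyClosure_mono hB hx
  rw [hg.mem_polyClosure_iff] at this
  rw [(hg.contract c).mem_polyClosure_iff]
  unfold contraction
  rw [← Set.insert_union]
  linarith

end

/-- The points of the amalgam that become the basis of the geometry of rank four. -/
def basisVertex : Fin 4 → Fin 3 × Bool := ![(0, false), (1, false), (2, false), (2, true)]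

/-- The point that serves as `b_i` on the line from `b_i` to `b_j`. This is the basis vertex, except
that for `i = 2`, `j = 3` both basis vertices lie over the same point of the geometry of rank three,
and a point over `b_1` is used that is parallel to `b_2` after the contraction. -/
def lineVertex (i j : Fin 4) : Fin 3 × Bool :=
  if i = 2 ∧ j = 3 then (1, true) else basisVertex i

theorem lineVertex_fst_ne {i j : Fin 4} (hij : i ≠ j) :
    (lineVertex i j).1 ≠ (lineVertex j i).1 := by
  revert i j; decide

section
variable {S E F : Type*} {σ : GenStructure S} {G : PDG 3 σ E} {g : Set F → ℝ}
  {κ : (Fin 3 → Bool) → E → F}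

/-- The element to be contracted, which makes the second point over `b_1` parallel to the first
point over `b_2`. -/
def pivot (G : PDG 3 σ E) (κ : (Fin 3 → Bool) → E → F) : F := edge G κ (1, true) (2, false) σ.e

variable (h : IsAmalgam G g κ)
include h

theorem IsAmalgam.contract : IsPolymatroid (contraction g (pivot G κ)) :=
  h.isPolymatroid.contract _

/-- After the contraction, the vertices used on the lines through `b_i` are parallel to `b_i`. -/
theorem IsAmalgam.lineVertex_mem (i j : Fin 4) :
    vtx G κ (lineVertex i j) ∈
      polyClosure (contraction g (pivot G κ)) {vtx G κ (basisVertex i)} := by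
  unfold lineVertex
  split_ifs with hij
  · obtain ⟨rfl, rfl⟩ := hij
    have := h.vtx_mem_polyClosure (u := (2, false)) (v := (1, true)) (by decide) σ.e
    rw [h.edge_e_symm (by decide)] at this
    refine h.isPolymatroid.mem_polyClosure_contract this ?_
    rw [Set.pair_comm]; rfl
  · exact subset_polyClosure _ rfl

theorem IsAmalgam.basisVertex_mem (i j : Fin 4) :
    vtx G κ (basisVertex i) ∈
      polyClosure (contraction g (pivot G κ)) {vtx G κ (lineVertex i j)} := by
  unfold lineVertex
  split_ifs with hij
  · obtain ⟨rfl, rfl⟩ := hij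
    have := h.vtx_mem_polyClosure (u := (1, true)) (v := (2, false)) (by decide) σ.e
    refine h.isPolymatroid.mem_polyClosure_contract this ?_
    rw [Set.pair_comm]; rfl
  · exact subset_polyClosure _ rfl

theorem IsAmalgam.contract_vtx_le (v : Fin 3 × Bool) : contraction g (pivot G κ) {vtx G κ v} ≤ 1 :=
  (h.isPolymatroid.contract_le _ _).trans (h.rank_vtx v).le

theorem IsAmalgam.rank_pivot : g {pivot G κ} = 1 := h.rank_edge (by decide) _

/-- The four basis vertices and the pivot span the amalgam, which has rank five. -/
theorem IsAmalgam.four_le_contract :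
    4 ≤ contraction g (pivot G κ) (Set.range fun i => vtx G κ (basisVertex i)) := by
  have h5 := h.five_le
  have h1 : g _ ≤ g (insert (pivot G κ) (Set.range fun i => vtx G κ (basisVertex i))) :=
    h.isPolymatroid.le_of_subset_polyClosure (T := {vtx G κ (0, false), vtx G κ (1, false),
      vtx G κ (1, true), vtx G κ (2, false), vtx G κ (2, true)}) (Set.toFinite _) (by
      have hb : ∀ i, vtx G κ (basisVertex i) ∈
          insert (pivot G κ) (Set.range fun i => vtx G κ (basisVertex i)) :=
        fun i => .inr ⟨i, rfl⟩
      rintro x (rfl | rfl | rfl | rfl | rfl)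
      · exact subset_polyClosure _ (hb 0)
      · exact subset_polyClosure _ (hb 1)
      · have := h.vtx_mem_polyClosure (u := (2, false)) (v := (1, true)) (by decide) σ.e
        rw [h.edge_e_symm (by decide)] at this
        refine h.isPolymatroid.polyClosure_mono ?_ this
        rintro x (rfl | rfl)
        · exact hb 2
        · exact .inl rfl
      · exact subset_polyClosure _ (hb 2)
      · exact subset_polyClosure _ (hb 3))
  have h2 := h.rank_pivot
  unfold contraction
  have h3 : (5 : ℝ) ≤ g {vtx G κ (0, false), vtx G κ (1, false),
      vtx G κ (1, true), vtx G κ (2, false), vtx G κ (2, true)} := h5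
  linarith

end

/-- Points of rank at most one whose total rank is their number are independent. -/
theorem IsPolymatroid.rank_image_eq_ncard {F : Type*} {f : Set F → ℝ} (hf : IsPolymatroid f)
    {n : ℕ} {b : Fin n → F} (h1 : ∀ i, f {b i} ≤ 1) (hn : n ≤ f (Set.range b)) (T : Set (Fin n)) :
    f (b '' T) = T.ncard := by
  have hle : ∀ T : Set (Fin n), f (b '' T) ≤ T.ncard := by
    intro T
    induction T, T.toFinite using Set.Finite.induction_on with
    | empty => simp [hf.empty]
    | @insert i T hi hT ih =>
      rw [Set.image_insert_eq, Set.ncard_insert_of_notMem hi hT]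
      push_cast
      linarith [hf.insert_le (b i) (b '' T), h1 i]
  refine le_antisymm (hle T) ?_
  have h2 := hf.union_le (b '' T) (b '' Tᶜ)
  rw [← Set.image_union, Set.union_compl_self, Set.image_univ] at h2
  have h3 : (T.ncard : ℝ) + (Tᶜ.ncard : ℝ) = n := by
    have := Set.ncard_add_ncard_compl T
    rw [Nat.card_fin] at this
    exact_mod_cast this
  linarith [hle Tᶜ]

section
variable {S E F : Type*} {σ : GenStructure S} {G : PDG 3 σ E} {g : Set F → ℝ}
  {κ : (Fin 3 → Bool) → E → F}

/-- The element that becomes `s_{i,j}` in the geometry of rank four. -/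
def newLab (G : PDG 3 σ E) (κ : (Fin 3 → Bool) → E → F) (i j : Fin 4) (s : S) : F :=
  edge G κ (lineVertex i j) (lineVertex j i) s

variable (h : IsAmalgam G g κ)
include h

theorem IsAmalgam.newLab_symm {i j : Fin 4} (hij : i ≠ j) (s : S) :
    newLab G κ j i (σ.inv s) = newLab G κ i j s :=
  h.edge_symm (lineVertex_fst_ne hij) s

theorem IsAmalgam.contract_basis (T : Set (Fin 4)) :
    contraction g (pivot G κ) ((fun i => vtx G κ (basisVertex i)) '' T) = T.ncard :=
  h.contract.rank_image_eq_ncard (fun _ => h.contract_vtx_le _)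
    (by exact_mod_cast h.four_le_contract) T

theorem IsAmalgam.contract_basis_pair {i j : Fin 4} (hij : i ≠ j) :
    contraction g (pivot G κ) {vtx G κ (basisVertex i), vtx G κ (basisVertex j)} = 2 := by
  have := h.contract_basis {i, j}
  rwa [Set.image_pair, Set.ncard_pair hij] at this

theorem IsAmalgam.contract_basis_triple {i j k : Fin 4} (hij : i ≠ j) (hjk : j ≠ k) (hki : k ≠ i) :
    contraction g (pivot G κ) {vtx G κ (basisVertex i), vtx G κ (basisVertex j),
      vtx G κ (basisVertex k)} = 3 := by
  have := h.contract_basis {i, j, k}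
  rwa [Set.image_insert_eq, Set.image_pair, Set.ncard_eq_three.2 ⟨i, j, k, hij, hki.symm, hjk, rfl⟩]
    at this

theorem IsAmalgam.newLab_mem {i j : Fin 4} (hij : i ≠ j) (s : S) :
    newLab G κ i j s ∈ polyClosure (contraction g (pivot G κ))
      {vtx G κ (basisVertex i), vtx G κ (basisVertex j)} := by
  refine h.contract.mem_polyClosure_trans (Set.toFinite _)
    (h.isPolymatroid.mem_polyClosure_contract
      (h.edge_mem_polyClosure (lineVertex_fst_ne hij) s) (Set.subset_insert _ _)) ?_
  rintro x (rfl | rfl)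
  · exact h.contract.polyClosure_mono (by simp) (h.lineVertex_mem i j)
  · exact h.contract.polyClosure_mono (by simp) (h.lineVertex_mem j i)

theorem IsAmalgam.basis_mem {i j : Fin 4} (hij : i ≠ j) (s : S) :
    vtx G κ (basisVertex j) ∈ polyClosure (contraction g (pivot G κ))
      {vtx G κ (basisVertex i), newLab G κ i j s} := by
  have h1 : vtx G κ (lineVertex j i) ∈ polyClosure (contraction g (pivot G κ))
      {vtx G κ (basisVertex i), newLab G κ i j s} := by
    refine h.contract.mem_polyClosure_trans (Set.toFinite _)
      (h.isPolymatroid.mem_polyClosure_contract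
        (h.vtx_mem_polyClosure (lineVertex_fst_ne hij) s) (Set.subset_insert _ _)) ?_
    rintro x (rfl | rfl)
    · exact h.contract.polyClosure_mono (by simp) (h.lineVertex_mem i j)
    · exact subset_polyClosure _ (by simp [newLab])
  exact h.contract.mem_polyClosure_trans (Set.toFinite _) (h.basisVertex_mem j i)
    (Set.singleton_subset_iff.2 h1)

theorem IsAmalgam.contract_basis_newLab {i j : Fin 4} (hij : i ≠ j) (s : S) :
    contraction g (pivot G κ) {vtx G κ (basisVertex i), newLab G κ i j s} = 2 := by
  refine le_antisymm ?_ ?_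
  · rw [← h.contract_basis_pair hij]
    refine h.contract.le_of_subset_polyClosure (Set.toFinite _) ?_
    rintro x (rfl | rfl)
    · exact subset_polyClosure _ (by simp)
    · exact h.newLab_mem hij s
  · rw [← h.contract_basis_pair hij]
    refine h.contract.le_of_subset_polyClosure (Set.toFinite _) ?_
    rintro x (rfl | rfl)
    · exact subset_polyClosure _ (by simp)
    · exact h.basis_mem hij s

theorem IsAmalgam.contract_newLab_le {i j : Fin 4} (hij : i ≠ j) (s : S) :
    contraction g (pivot G κ) {newLab G κ i j s} ≤ 1 :=
  (h.isPolymatroid.contract_le _ _).trans (h.rank_edge (lineVertex_fst_ne hij) s).le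

theorem IsAmalgam.contract_newLab {i j : Fin 4} (hij : i ≠ j) (s : S) :
    contraction g (pivot G κ) {newLab G κ i j s} = 1 := by
  have h1 := h.contract_newLab_le hij s
  have h2 := h.contract_basis_newLab hij s
  have h3 := h.contract.insert_le (vtx G κ (basisVertex i)) {newLab G κ i j s}
  have h4 := h.contract_vtx_le (basisVertex i)
  exact le_antisymm h1 (by linarith)

theorem IsAmalgam.two_le_contract_newLab_pair {i j k : Fin 4} (hij : i ≠ j) (hkj : k ≠ j)
    (hki : k ≠ i) (s t : S) :
    2 ≤ contraction g (pivot G κ) {newLab G κ i j s, newLab G κ i k t} :=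
  h.contract.two_le_pair (h.contract_basis_triple hij hkj.symm hki).ge (h.contract_vtx_le _)
    (h.basis_mem hij s) (h.basis_mem hki.symm t)

/-- Coherence of three lines that become parallel to the lines of one of the copies of `G`. -/
theorem IsAmalgam.contract_triple_le {i j k : Fin 4} (w : Fin 4 → Fin 3 × Bool)
    (hij : (w i).1 ≠ (w j).1) (hkj : (w k).1 ≠ (w j).1) (hki : (w k).1 ≠ (w i).1) (s : S)
    (h1 : newLab G κ i j s ∈ polyClosure (contraction g (pivot G κ)) {edge G κ (w i) (w j) s})
    (h2 : newLab G κ k j s ∈ polyClosure (contraction g (pivot G κ)) {edge G κ (w k) (w j) s})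
    (h3 : newLab G κ k i σ.e ∈ polyClosure (contraction g (pivot G κ)) {edge G κ (w k) (w i) σ.e}) :
    contraction g (pivot G κ) {newLab G κ i j s, newLab G κ k j s, newLab G κ k i σ.e} ≤ 2 := by
  have hp := h.contract
  have hle : contraction g (pivot G κ) {newLab G κ i j s, newLab G κ k j s, newLab G κ k i σ.e} ≤
      contraction g (pivot G κ) {edge G κ (w k) (w j) s, edge G κ (w k) (w i) σ.e} := by
    refine hp.le_of_subset_polyClosure (Set.toFinite _) ?_
    rintro x (rfl | rfl | rfl)
    · refine hp.mem_polyClosure_trans (Set.toFinite _) h1 (Set.singleton_subset_iff.2 ?_)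
      exact h.isPolymatroid.mem_polyClosure_contract (h.edge_mem_polyClosure_edges hij hkj hki s)
        (Set.subset_insert _ _)
    · exact hp.polyClosure_mono (by simp) h2
    · exact hp.polyClosure_mono (by simp) h3
  have h4 := hp.insert_le (edge G κ (w k) (w j) s) {edge G κ (w k) (w i) σ.e}
  have h5 := (h.isPolymatroid.contract_le (pivot G κ) _).trans (h.rank_edge hkj s).le
  have h6 := (h.isPolymatroid.contract_le (pivot G κ) _).trans (h.rank_edge hki σ.e).le
  linarith

/-- Lines from `b_0` to the two points that become parallel become parallel elementwise. -/
theorem IsAmalgam.edge_parallel (s : S) :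
    edge G κ (0, false) (2, false) s ∈
      polyClosure (contraction g (pivot G κ)) {edge G κ (0, false) (1, true) s} := by
  have := h.edge_mem_polyClosure_edges (u := (2, false)) (v := (0, false)) (w := (1, true))
    (by decide) (by decide) (by decide) (σ.inv s)
  rw [h.edge_symm (by decide), h.edge_symm (by decide)] at this
  refine h.isPolymatroid.mem_polyClosure_contract this ?_
  rw [Set.pair_comm]; rfl

theorem IsAmalgam.edge_parallel' (s : S) :
    edge G κ (2, false) (0, false) s ∈
      polyClosure (contraction g (pivot G κ)) {edge G κ (1, true) (0, false) s} := by
  have := h.edge_parallel (σ.inv s)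
  rwa [h.edge_symm (by decide), h.edge_symm (by decide)] at this

/-- Coherence of the three lines that do not meet `b_0`. Together with the contracted element
they lie in two sets of rank four, spanned by four points and by four elements on lines through
`b_0`, whose union has rank five. -/
theorem IsAmalgam.contract_triple_le_of_ne_zero {i j k : Fin 4} (hij : i ≠ j) (hkj : k ≠ j)
    (hki : k ≠ i) (hi : i ≠ 0) (hj : j ≠ 0) (hk : k ≠ 0) (s : S) :
    contraction g (pivot G κ) {newLab G κ i j s, newLab G κ k j s, newLab G κ k i σ.e} ≤ 2 := by
  have hp := h.isPolymatroid
  -- The labels are chosen so that each of the three elements is spanned by two elements of `B`: a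
  -- line between points with labels `e` and `s` gives its element `s`, one between equal labels
  -- gives its element `e`.
  -- The two points that become parallel carry the same label, whence `c` is spanned by `B` as well.
  let l : Fin 4 → S := fun m => if m = j then s else σ.e
  have lj : l j = s := if_pos rfl
  have li : l i = σ.e := if_neg hij
  have lk : l k = σ.e := if_neg hkj
  let o : Fin 3 × Bool := (0, false)
  let A : Set F := {vtx G κ (1, false), vtx G κ (2, false), vtx G κ (1, true), vtx G κ (2, true)}
  let B : Set F := {edge G κ o (1, false) (l 1), edge G κ o (2, false) (l 2),
    edge G κ o (1, true) (l 2), edge G κ o (2, true) (l 3)}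
  set T : Set F := {newLab G κ i j s, newLab G κ k j s, newLab G κ k i σ.e} with hT
  have ho : ∀ i j : Fin 4, i ≠ 0 → o.1 ≠ (lineVertex i j).1 := by decide
  have hAm : ∀ i j : Fin 4, i ≠ 0 → vtx G κ (lineVertex i j) ∈ A := by
    have : ∀ i j : Fin 4, i ≠ 0 → lineVertex i j = (1, false) ∨ lineVertex i j = (2, false) ∨
      lineVertex i j = (1, true) ∨ lineVertex i j = (2, true) := by decide
    intro i j hi
    rcases this i j hi with e | e | e | e <;> rw [e] <;> simp [A]
  have hBm : ∀ i j : Fin 4, i ≠ 0 → edge G κ o (lineVertex i j) (l i) ∈ B := by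
    have : ∀ i j : Fin 4, i ≠ 0 → (i = 1 ∧ lineVertex i j = (1, false)) ∨
      (i = 2 ∧ lineVertex i j = (2, false)) ∨ (i = 2 ∧ lineVertex i j = (1, true)) ∨
      (i = 3 ∧ lineVertex i j = (2, true)) := by decide
    intro i j hi
    rcases this i j hi with ⟨e', e⟩ | ⟨e', e⟩ | ⟨e', e⟩ | ⟨e', e⟩ <;> rw [e, e'] <;> simp [B]
  have hA : ∀ i j : Fin 4, i ≠ j → i ≠ 0 → j ≠ 0 → ∀ s, newLab G κ i j s ∈ polyClosure g A := by
    intro i j hij hi hj s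
    refine hp.polyClosure_mono ?_ (h.edge_mem_polyClosure (lineVertex_fst_ne hij) s)
    rintro x (rfl | rfl)
    exacts [hAm i j hi, hAm j i hj]
  have hB : ∀ i, i ≠ j → i ≠ 0 → newLab G κ i j s ∈ polyClosure g B := by
    intro i hij hi
    refine hp.polyClosure_mono ?_ (h.edge_mem_polyClosure_edges (w := o) (lineVertex_fst_ne hij)
      (ho j i hj) (ho i j hi) s)
    have e1 := hBm j i hj
    have e2 := hBm i j hi
    rw [lj] at e1
    rw [show l i = σ.e from if_neg hij] at e2
    rintro x (rfl | rfl)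
    exacts [e1, e2]
  have hBe : ∀ u v : Fin 3 × Bool, u.1 ≠ v.1 → o.1 ≠ u.1 → o.1 ≠ v.1 → ∀ t,
      edge G κ o u t ∈ B → edge G κ o v t ∈ B → edge G κ u v σ.e ∈ polyClosure g B := by
    intro u v huv hu hv t h1 h2
    have := h.edge_e_mem_polyClosure_edges (u := v) (v := o) (w := u) hv.symm hu.symm huv (σ.inv t)
    rw [h.edge_symm hv, h.edge_symm hu] at this
    refine hp.polyClosure_mono ?_ this
    rintro x (rfl | rfl)
    exacts [h2, h1]
  have hTA : insert (pivot G κ) T ⊆ polyClosure g A := by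
    rintro x (rfl | rfl | rfl | rfl)
    · refine hp.polyClosure_mono ?_ (h.edge_mem_polyClosure (by decide) σ.e)
      rintro x (rfl | rfl) <;> simp [A]
    · exact hA _ _ hij hi hj _
    · exact hA _ _ hkj hk hj _
    · exact hA _ _ hki hk hi _
  have hTB : insert (pivot G κ) T ⊆ polyClosure g B := by
    rintro x (rfl | rfl | rfl | rfl)
    · exact hBe _ _ (by decide) (by decide) (by decide) (l 2) (by simp [B]) (by simp [B])
    · exact hB _ hij hi
    · exact hB _ hkj hk
    · refine hBe _ _ (lineVertex_fst_ne hki) (ho k i hk) (ho i k hi) σ.e ?_ ?_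
      · rw [← lk]; exact hBm k i hk
      · rw [← li]; exact hBm i k hi
  have hfin : (insert (pivot G κ) T).Finite := Set.toFinite _
  have hrA : g A ≤ 4 := by
    have e1 := hp.insert_le (vtx G κ (1, false))
      {vtx G κ (2, false), vtx G κ (1, true), vtx G κ (2, true)}
    have e2 := hp.insert_le (vtx G κ (2, false)) {vtx G κ (1, true), vtx G κ (2, true)}
    have e3 := hp.insert_le (vtx G κ (1, true)) {vtx G κ (2, true)}
    rw [h.rank_vtx] at e1 e2
    rw [h.rank_vtx, h.rank_vtx] at e3
    change g {_, _, _, _} ≤ 4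
    linarith
  have hrB : g B ≤ 4 := by
    have e1 := hp.insert_le (edge G κ o (1, false) (l 1)) {edge G κ o (2, false) (l 2),
      edge G κ o (1, true) (l 2), edge G κ o (2, true) (l 3)}
    have e2 := hp.insert_le (edge G κ o (2, false) (l 2)) {edge G κ o (1, true) (l 2),
      edge G κ o (2, true) (l 3)}
    have e3 := hp.insert_le (edge G κ o (1, true) (l 2)) {edge G κ o (2, true) (l 3)}
    rw [h.rank_edge (by decide)] at e1 e2
    rw [h.rank_edge (by decide), h.rank_edge (by decide)] at e3
    change g {_, _, _, _} ≤ 4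
    linarith
  have hAB : 5 ≤ g (A ∪ B) := by
    refine h.five_le.trans (hp.le_of_subset_polyClosure (T := {vtx G κ o, vtx G κ (1, false),
      vtx G κ (1, true), vtx G κ (2, false), vtx G κ (2, true)}) (Set.toFinite _) ?_)
    rintro x (rfl | rfl | rfl | rfl | rfl)
    · have := h.vtx_mem_polyClosure (u := (1, false)) (v := o) (by decide) (σ.inv (l 1))
      rw [h.edge_symm (by decide)] at this
      refine hp.polyClosure_mono ?_ this
      rintro x (rfl | rfl) <;> simp [A, B]
    all_goals exact subset_polyClosure _ (by simp [A])
  have e1 := hp.union_le_of_subset_polyClosure hfin hTA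
  have e2 := hp.union_le_of_subset_polyClosure hfin hTB
  have e3 := hp.submodular (A ∪ insert (pivot G κ) T) (B ∪ insert (pivot G κ) T)
  have e4 := hp.mono (A ∪ B) (A ∪ insert (pivot G κ) T ∪ (B ∪ insert (pivot G κ) T))
    (Set.union_subset_union Set.subset_union_left Set.subset_union_left)
  have e5 := hp.mono (insert (pivot G κ) T)
    ((A ∪ insert (pivot G κ) T) ∩ (B ∪ insert (pivot G κ) T))
    (Set.subset_inter Set.subset_union_right Set.subset_union_right)
  have e6 := h.rank_pivot
  unfold contraction
  linarith

theorem IsAmalgam.contract_coherent {i j k : Fin 4} (hij : i ≠ j) (hkj : k ≠ j) (hki : k ≠ i)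
    (s : S) :
    contraction g (pivot G κ) {newLab G κ i j s, newLab G κ k j s, newLab G κ k i σ.e} = 2 := by
  refine le_antisymm ?_ ?_
  · by_cases h0 : i ≠ 0 ∧ j ≠ 0 ∧ k ≠ 0
    · exact h.contract_triple_le_of_ne_zero hij hkj hki h0.1 h0.2.1 h0.2.2 s
    by_cases h23 : (i = 2 ∨ j = 2 ∨ k = 2) ∧ (i = 3 ∨ j = 3 ∨ k = 3)
    · -- the lines through `b_2` may be moved to the point parallel to it
      let w : Fin 4 → Fin 3 × Bool := ![(0, false), (1, false), (1, true), (2, true)]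
      have hcase : ∀ i j : Fin 4, i ≠ j → i ≠ 1 → j ≠ 1 →
          (lineVertex i j = w i ∧ lineVertex j i = w j) ∨
          (lineVertex i j = (0, false) ∧ lineVertex j i = (2, false) ∧ w i = (0, false) ∧
            w j = (1, true)) ∨
          (lineVertex i j = (2, false) ∧ lineVertex j i = (0, false) ∧ w i = (1, true) ∧
            w j = (0, false)) := by decide
      have hpar : ∀ i j : Fin 4, i ≠ j → i ≠ 1 → j ≠ 1 → ∀ s, newLab G κ i j s ∈
          polyClosure (contraction g (pivot G κ)) {edge G κ (w i) (w j) s} := by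
        intro i j hij hi hj s
        unfold newLab
        rcases hcase i j hij hi hj with ⟨e1, e2⟩ | ⟨e1, e2, e3, e4⟩ | ⟨e1, e2, e3, e4⟩
        · rw [e1, e2]; exact subset_polyClosure _ rfl
        · rw [e1, e2, e3, e4]; exact h.edge_parallel s
        · rw [e1, e2, e3, e4]; exact h.edge_parallel' s
      have hne : i ≠ 1 ∧ j ≠ 1 ∧ k ≠ 1 := by
        clear hpar hcase
        omega
      have hw : ∀ i j : Fin 4, i ≠ j → i ≠ 1 → j ≠ 1 → (w i).1 ≠ (w j).1 := by decide
      exact h.contract_triple_le w (hw _ _ hij hne.1 hne.2.1) (hw _ _ hkj hne.2.2 hne.2.1)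
        (hw _ _ hki hne.2.2 hne.1) s (hpar _ _ hij hne.1 hne.2.1 _)
        (hpar _ _ hkj hne.2.2 hne.2.1 _) (hpar _ _ hki hne.2.2 hne.1 _)
    · have hcase : ∀ i j : Fin 4, i ≠ j → ¬ ((i = 2 ∨ j = 2) ∧ (i = 3 ∨ j = 3)) →
          lineVertex i j = basisVertex i ∧ lineVertex j i = basisVertex j ∧
            (basisVertex i).1 ≠ (basisVertex j).1 := by decide
      have hpar : ∀ i j : Fin 4, i ≠ j → ¬ ((i = 2 ∨ j = 2) ∧ (i = 3 ∨ j = 3)) → ∀ s,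
          newLab G κ i j s ∈ polyClosure (contraction g (pivot G κ))
            {edge G κ (basisVertex i) (basisVertex j) s} := by
        intro i j hij hn s
        obtain ⟨e1, e2, -⟩ := hcase i j hij hn
        unfold newLab
        rw [e1, e2]; exact subset_polyClosure _ rfl
      have n1 : ¬ ((i = 2 ∨ j = 2) ∧ (i = 3 ∨ j = 3)) := by tauto
      have n2 : ¬ ((k = 2 ∨ j = 2) ∧ (k = 3 ∨ j = 3)) := by tauto
      have n3 : ¬ ((k = 2 ∨ i = 2) ∧ (k = 3 ∨ i = 3)) := by tauto
      exact h.contract_triple_le basisVertex (hcase _ _ hij n1).2.2 (hcase _ _ hkj n2).2.2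
        (hcase _ _ hki n3).2.2 s (hpar _ _ hij n1 _) (hpar _ _ hkj n2 _) (hpar _ _ hki n3 _)
  · have h1 := h.two_le_contract_newLab_pair hij.symm hki hkj (σ.inv s) (σ.inv s)
    rw [h.newLab_symm hij, h.newLab_symm hkj] at h1
    refine h1.trans (h.contract.mono _ _ ?_)
    rintro x (rfl | rfl) <;> simp

/-- The contracted element is in general position with respect to the original geometry. -/
theorem IsAmalgam.contract_image (hG : IsFiniteType G.rank) (A : Set E) :
    contraction g (pivot G κ) (κ (fun _ => false) '' A) = G.rank A := by
  have hp := h.contract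
  refine le_antisymm ((h.isPolymatroid.contract_le _ _).trans (h.rank_image _ A).le) ?_
  let κ₀ := κ fun _ => false
  have h1 : 3 ≤ contraction g (pivot G κ) (κ₀ '' Set.univ) := by
    rw [← h.contract_basis_triple (i := 0) (j := 1) (k := 2) (by decide) (by decide) (by decide)]
    refine hp.mono _ _ ?_
    rintro x (rfl | rfl | rfl)
    exacts [⟨G.b 0, trivial, rfl⟩, ⟨G.b 1, trivial, rfl⟩, ⟨G.b 2, trivial, rfl⟩]
  have h2 : g (κ₀ '' Set.univ) ≤ 3 := by
    rw [h.rank_image]; exact_mod_cast G.rank_univ_le hG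
  have h3 := h.isPolymatroid.submodular (insert (pivot G κ) (κ₀ '' A)) (κ₀ '' Set.univ)
  have h4 := h.isPolymatroid.mono (insert (pivot G κ) (κ₀ '' Set.univ))
    (insert (pivot G κ) (κ₀ '' A) ∪ κ₀ '' Set.univ) (by
      rintro x (rfl | hx)
      exacts [.inl (.inl rfl), .inr hx])
  have h5 := h.isPolymatroid.mono (κ₀ '' A) (insert (pivot G κ) (κ₀ '' A) ∩ κ₀ '' Set.univ)
    (Set.subset_inter (Set.subset_insert _ _) (Set.image_mono (Set.subset_univ A)))
  have h6 := h.rank_image (fun _ => false) A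
  unfold contraction at h1 ⊢
  linarith

end

/-! ### The geometry of rank four -/

section
variable {S E F T : Type*} {σ : GenStructure S} {G : PDG 3 σ E} {g : Set F → ℝ}
  {κ : (Fin 3 → Bool) → E → F}

/-- The realization in the amalgam of the ground set of a geometry of rank four. The type `T` is a
copy of `S`. -/
def realize (G : PDG 3 σ E) (κ : (Fin 3 → Bool) → E → F) (e : T ≃ S) :
    Fin 4 ⊕ (IndexPair 4 × T) → F :=
  Sum.elim (fun i => vtx G κ (basisVertex i)) fun q => newLab G κ q.1.1.1 q.1.1.2 (e q.2)

/-- The element `s_{i,j}` for `i < j`. -/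
def newPt (e : T ≃ S) (q : IndexPair 4) (s : S) : Fin 4 ⊕ (IndexPair 4 × T) :=
  Sum.inr (q, e.symm s)

theorem IsAmalgam.realize_labelled (h : IsAmalgam G g κ) (e : T ≃ S) {i j : Fin 4} (hij : i ≠ j)
    (s : S) : realize G κ e (labelled σ (newPt e) i j hij s) = newLab G κ i j s := by
  unfold labelled
  split_ifs with hlt
  · simp [realize, newPt]
  · simp only [realize, newPt, Sum.elim_inr, e.apply_symm_apply]
    exact h.newLab_symm hij s

/-- The rank function of the geometry of rank four. -/
noncomputable def newRank (G : PDG 3 σ E) (g : Set F → ℝ) (κ : (Fin 3 → Bool) → E → F)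
    (e : T ≃ S) : Set (Fin 4 ⊕ (IndexPair 4 × T)) → ℝ :=
  finitary fun A => contraction g (pivot G κ) (realize G κ e '' A)

theorem IsPolymatroid.comap {F' : Type*} {f : Set F → ℝ} (hf : IsPolymatroid f) (φ : F' → F) :
    IsPolymatroid fun A => f (φ '' A) := by
  refine ⟨by simp [hf.empty], fun A B hAB => hf.mono _ _ (Set.image_mono hAB), fun A B => ?_⟩
  have h1 := hf.submodular (φ '' A) (φ '' B)
  have h2 := hf.mono _ _ (Set.image_inter_subset φ A B)
  rw [Set.image_union]
  linarith

theorem IsAmalgam.newRank_of_finite (h : IsAmalgam G g κ) (e : T ≃ S)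
    {A : Set (Fin 4 ⊕ (IndexPair 4 × T))} (hA : A.Finite) :
    newRank G g κ e A = contraction g (pivot G κ) (realize G κ e '' A) :=
  (h.contract.comap _).finitary_of_finite hA

/-- The geometry of rank four. -/
noncomputable def IsAmalgam.pdg (h : IsAmalgam G g κ) (e : T ≃ S) :
    PDG 4 σ (Fin 4 ⊕ (IndexPair 4 × T)) where
  rank := newRank G g κ e
  isPolymatroid := (h.contract.comap _).isPolymatroid_finitary
  b := Sum.inl
  pt := newPt e
  partition := by
    have : Sum.elim Sum.inl (fun q : IndexPair 4 × S => newPt e q.1 q.2) =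
        Equiv.sumCongr (Equiv.refl (Fin 4)) ((Equiv.refl (IndexPair 4)).prodCongr e.symm) := by
      funext x
      rcases x with i | q <;> rfl
    rw [this]
    exact Equiv.bijective _
  basis A hA := by
    obtain ⟨J, rfl⟩ := Set.subset_range_iff_exists_image_eq.1 hA
    rw [h.newRank_of_finite e (Set.toFinite _), Set.image_image,
      Set.ncard_image_of_injective _ Sum.inl_injective]
    exact h.contract_basis J
  frame i j hij s := by
    have hm := h.newLab_mem hij s
    change newRank G g κ e _ = newRank G g κ e _
    rw [h.newRank_of_finite e (Set.toFinite _), h.newRank_of_finite e (Set.toFinite _),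
      Set.image_union, Set.image_pair, Set.image_singleton, h.realize_labelled]
    exact hm
  nondegenerate i j hij s := by
    rw [h.newRank_of_finite e (Set.toFinite _), h.newRank_of_finite e (Set.toFinite _),
      Set.image_pair, Set.image_singleton, h.realize_labelled]
    exact ⟨h.contract_newLab hij s, h.contract_basis_newLab hij s⟩
  coherent i j k hij hjk hki s := by
    rw [h.newRank_of_finite e (Set.toFinite _), Set.image_insert_eq, Set.image_pair,
      h.realize_labelled, h.realize_labelled, h.realize_labelled, h.newLab_symm hjk.symm]
    exact h.contract_coherent hij hjk.symm hki s

end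

/-- The map of ground sets that preserves indices and labels. -/
theorem PDG.exists_embedding {S E F : Type*} {σ : GenStructure S} (G : PDG 3 σ E)
    (G' : PDG 4 σ F) : ∃ η : E → F, Function.Injective η ∧
      (∀ i, η (G.b i) = G'.b (Fin.castLE (by norm_num) i)) ∧
      ∀ (q : IndexPair 3) (s : S), η (G.pt q s) =
        G'.pt ⟨(Fin.castLE (by norm_num) q.1.1, Fin.castLE (by norm_num) q.1.2), q.2⟩ s := by
  have hc : Function.Injective (Fin.castLE (by norm_num : 3 ≤ 4)) := Fin.castLE_injective _
  let c : IndexPair 3 → IndexPair 4 := fun q =>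
    ⟨(Fin.castLE (by norm_num) q.1.1, Fin.castLE (by norm_num) q.1.2), q.2⟩
  have hcinj : Function.Injective c := by
    rintro ⟨⟨i, j⟩, hq⟩ ⟨⟨i', j'⟩, hq'⟩ h
    simp only [c, Subtype.mk.injEq, Prod.mk.injEq] at h
    simp only [Subtype.mk.injEq, Prod.mk.injEq]
    exact ⟨hc h.1, hc h.2⟩
  let ε := Equiv.ofBijective _ G.partition
  let m : Fin 3 ⊕ (IndexPair 3 × S) → Fin 4 ⊕ (IndexPair 4 × S) :=
    Sum.map (Fin.castLE (by norm_num)) (Prod.map c id)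
  have hm : Function.Injective m := hc.sumMap (hcinj.prodMap Function.injective_id)
  refine ⟨fun x => Sum.elim G'.b (fun q : IndexPair 4 × S => G'.pt q.1 q.2) (m (ε.symm x)),
    G'.partition.1.comp (hm.comp ε.symm.injective), fun i => ?_, fun q s => ?_⟩
  · have : ε.symm (G.b i) = Sum.inl i := ε.symm_apply_eq.2 rfl
    simp only [this]; rfl
  · have : ε.symm (G.pt q s) = Sum.inr (q, s) := ε.symm_apply_eq.2 rfl
    simp only [this]; rfl

theorem labelled_castLE {S E F : Type*} {σ : GenStructure S} (G : PDG 3 σ E) (G' : PDG 4 σ F)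
    {η : E → F} (hη : ∀ (q : IndexPair 3) (s : S), η (G.pt q s) =
      G'.pt ⟨(Fin.castLE (by norm_num) q.1.1, Fin.castLE (by norm_num) q.1.2), q.2⟩ s)
    (i j : Fin 3) (hij : i ≠ j) (s : S) :
    η (labelled σ G.pt i j hij s) = labelled σ G'.pt (Fin.castLE (by norm_num) i)
      (Fin.castLE (by norm_num) j) ((Fin.castLE_injective (by norm_num)).ne hij) s := by
  unfold labelled
  by_cases hlt : i < j
  · have hlt' : Fin.castLE (by norm_num : 3 ≤ 4) i < Fin.castLE (by norm_num) j := hlt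
    rw [dif_pos hlt, dif_pos hlt', hη]
  · have hlt' : ¬ Fin.castLE (by norm_num : 3 ≤ 4) i < Fin.castLE (by norm_num) j := hlt
    rw [dif_neg hlt, dif_neg hlt', hη]

theorem mainTheorem3 {S : Type u} [Countable S] (σ : GenStructure S) {E : Type v}
    (G : PDG 3 σ E) (hG : IsAlmostEntropic G.rank) :
    ∃ (E' : Type v) (G' : PDG 4 σ E') (η : E → E'),
      IsAlmostEntropic G'.rank ∧ G.IsExtension (by norm_num) G' η := by
  obtain ⟨F, g, κ, hg, h⟩ := exists_isAmalgam G hG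
  -- `S` embeds into `E`, so that it has a copy in the universe of `E`
  have hsmall : Small.{v} S := by
    refine small_of_injective (β := E) (f := fun s => G.pt ⟨(0, 1), by decide⟩ s) fun s t hst => ?_
    have := G.partition.1 (a₁ := Sum.inr (_, s)) (a₂ := Sum.inr (_, t)) hst
    simpa using this
  let e : Shrink.{v} S ≃ S := (equivShrink S).symm
  have : Countable (Shrink.{v} S) := e.countable_iff.2 inferInstance
  obtain ⟨η, hinj, hb, hpt⟩ := G.exists_embedding (h.pdg e)
  refine ⟨_, h.pdg e, η, ?_, hinj, ?_, hb, labelled_castLE G _ hpt⟩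
  · exact isAlmostEntropic_finitary (comap_mem_entClosure (contract_mem_entClosure hg _) _)
  · have hηκ : ∀ x, realize G κ e (η x) = κ (fun _ => false) x := by
      intro x
      obtain ⟨y, rfl⟩ := G.partition.2 x
      rcases y with i | ⟨⟨⟨i, j⟩, hij⟩, s⟩
      · rw [Sum.elim_inl, hb]
        change vtx G κ (basisVertex (Fin.castLE _ i)) = _
        have hv : ∀ i : Fin 3, basisVertex (Fin.castLE (by norm_num) i) = (i, false) := by decide
        rw [hv]; rfl
      · rw [Sum.elim_inr, hpt]
        have hv : ∀ i j : Fin 3, lineVertex (Fin.castLE (by norm_num) i)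
          (Fin.castLE (by norm_num) j) = (i, false) := by decide
        change newLab G κ (Fin.castLE (by norm_num) i) (Fin.castLE (by norm_num) j)
          (e (e.symm s)) = _
        rw [e.apply_symm_apply, newLab, hv, hv,
          h.edge_eq (t := fun _ => false) (Fin.ne_of_lt hij) rfl rfl]
        congr 1
        exact dif_pos hij
    have hfin : ∀ A : Set E, contraction g (pivot G κ) (realize G κ e '' (η '' A)) = G.rank A := by
      intro A
      rw [Set.image_image]
      simp_rw [hηκ]
      exact h.contract_image hG.isFiniteType A
    have hp := h.contract.comap (realize G κ e)
    intro A
    refine le_antisymm ((hp.finitary_le fun K _ hK => hp.mono _ _ hK).trans (hfin A).le) ?_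
    refine (hG.isFiniteType A).2 ?_
    rintro _ ⟨K, hK, hKA, rfl⟩
    rw [← hfin K]
    exact hp.le_finitary (hK.image η) (Set.image_mono hKA)
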